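/- Let $m_0\in\mathbb{R}$, $m_0\neq 0$, let $I\subset(0,\infty)\cap(2m_0,\infty)$ be an interval with nonempty interior (for instance $I=[r_1,r_2]$ with $\max(0,2m_0)<r_1<r_2$), and let $H=\{x\in\mathbb{R}^3 : |x|\in I\}$ with $r=|x|$. On $H$ consider the time-symmetric Schwarzschild data $$\bar g_{m_0}=\Bigl(1-\frac{2m_0}{r}\Bigr)^{-1}dr^2+r^2\,d\sigma_{S^2}^2,\qquad \bar\pi=0 .$$ For a Riemannian metric $\bar g$ and a symmetric $2$-tensor $\bar\pi$ let $$\Phi(\bar g,\bar\pi)=\Bigl(R(\bar g)+\tfrac12(\mathrm{tr}_{\bar g}\bar\pi)^2-|\bar\pi|_{\bar g}^2,\ \mathrm{div}_{\bar g}\bar\pi\Bigr)$$ be the constraint map (with $\mathrm{div}_{\bar g}\bar\pi$ regarded as a vector field), let $D\Phi_{(\bar g,\bar\pi)}(h,\omega)=\frac{d}{dt}\big|_{t=0}\Phi(\bar g+th,\bar\pi+t\omega)$ be its linearization, and let $D\Phi^*_{(\bar g,\bar\pi)}$ be the formal $L^2(\bar g)$-adjoint, defined on pairs $(f,X)$ of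 a smooth function and a smooth vector field on $H$ by $$\int_H \bigl\langle (f,X),D\Phi_{(\bar g,\bar\pi)}(h,\omega)\bigr\rangle_{\bar g}\,d\mu_{\bar g}=\int_H\bigl\langle D\Phi^*_{(\bar g,\bar\pi)}(f,X),(h,\omega)\bigr\rangle_{\bar g}\,d\mu_{\bar g}$$ for all smooth symmetric $2$-tensors $h,\omega$ with compact support in the interior of $H$. Let $$\Omega_1=x^2\partial_3-x^3\partial_2,\qquad \Omega_2=x^3\partial_1-x^1\partial_3,\qquad \Omega_3=x^1\partial_2-x^2\partial_1 .$$ Then the kernel $$K=\mathrm{Ker}\,D\Phi^*_{(\bar g_{m_0},0)}$$ is a real vector space of dimension $4$, and it is spanned by $$\Bigl(\bigl(1-\tfrac{2m_0}{r}\bigr)^{1/2},0\Bigr),\quad (0,\Omega_1),\quad (0,\Omega_2),\quad (0,\Omega_3).$$ -/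

import Mathlib

open scoped ContDiff

noncomputable section

namespace Constraint

/-- Euclidean three-space, with its Cartesian coordinates `x 0, x 1, x 2`. -/
abbrev E3 := EuclideanSpace ℝ (Fin 3)

/-- Components `T_{ij}` of a covariant 2-tensor field in Cartesian coordinates. -/
abbrev Tensor2 := E3 → Matrix (Fin 3) (Fin 3) ℝ

/-- The coordinate partial derivative `∂_i u` at `x`. -/
def pd (i : Fin 3) (u : E3 → ℝ) (x : E3) : ℝ :=
  fderiv ℝ u x (EuclideanSpace.single i 1)

/-- The component `g^{ij}` of the inverse metric. -/
def ginv (g : Tensor2) (x : E3) (i j : Fin 3) : ℝ := (g x)⁻¹ i j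

/-- The Christoffel symbol `Γ^k_{ij}` of `g`. -/
def christoffel (g : Tensor2) (k i j : Fin 3) (x : E3) : ℝ :=
  (1 / 2) * ∑ l, ginv g x k l *
    (pd i (fun y => g y j l) x + pd j (fun y => g y i l) x - pd l (fun y => g y i j) x)

/-- The component `R_{ij}` of the Ricci tensor of `g`. -/
def ricci (g : Tensor2) (x : E3) (i j : Fin 3) : ℝ :=
  ∑ k, (pd k (christoffel g k i j) x - pd j (christoffel g k i k) x
    + ∑ l, (christoffel g k k l x * christoffel g l i j x
      - christoffel g k j l x * christoffel g l i k x))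

/-- The scalar curvature of `g`. -/
def scalarCurv (g : Tensor2) (x : E3) : ℝ := ∑ i, ∑ j, ginv g x i j * ricci g x i j

/-- The trace `g^{ij} p_{ij}`. -/
def traceAt (g p : Tensor2) (x : E3) : ℝ := ∑ i, ∑ j, ginv g x i j * p x i j

/-- The inner product `g^{ik} g^{jl} A_{ij} B_{kl}` of two covariant 2-tensors at `x`. -/
def inner2 (g : Tensor2) (x : E3) (A B : Matrix (Fin 3) (Fin 3) ℝ) : ℝ :=
  ∑ i, ∑ j, ∑ k, ∑ l, ginv g x i k * ginv g x j l * A i j * B k l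

/-- The inner product `g_{ij} V^i W^j` of two tangent vectors at `x`. -/
def inner1 (g : Tensor2) (x : E3) (V W : Fin 3 → ℝ) : ℝ := ∑ i, ∑ j, g x i j * V i * W j

/-- The covariant derivative `∇_j p_{kl}`. -/
def covDeriv (g p : Tensor2) (x : E3) (j k l : Fin 3) : ℝ :=
  pd j (fun y => p y k l) x
    - ∑ s, (christoffel g s j k x * p x s l + christoffel g s j l x * p x k s)

/-- The divergence `(div_g p)^i = g^{il} g^{jk} ∇_j p_{kl}`, as a vector field. -/
def divergence (g p : Tensor2) (x : E3) (i : Fin 3) : ℝ :=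
  ∑ l, ∑ j, ∑ k, ginv g x i l * ginv g x j k * covDeriv g p x j k l

/-- The Hamiltonian constraint `R(g) + (tr p)^2 / 2 - |p|^2`. -/
def hamiltonian (g p : Tensor2) (x : E3) : ℝ :=
  scalarCurv g x + (1 / 2) * traceAt g p x ^ 2 - inner2 g x (p x) (p x)

/-- The constraint map `Φ(g, p) = (H(g, p), div_g p)`. -/
def Phi (g p : Tensor2) (x : E3) : ℝ × (Fin 3 → ℝ) := (hamiltonian g p x, divergence g p x)

/-- The linearization `DΦ_{(g,p)}(h, w) = d/dt Φ(g + t h, p + t w)` at `t = 0`. -/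
def DPhi (g p h w : Tensor2) (x : E3) : ℝ × (Fin 3 → ℝ) :=
  (deriv (fun t : ℝ => (Phi (g + t • h) (p + t • w) x).1) 0,
    fun i => deriv (fun t : ℝ => (Phi (g + t • h) (p + t • w) x).2 i) 0)

/-- The Riemannian volume density `√(det g)`. -/
def volDensity (g : Tensor2) (x : E3) : ℝ := Real.sqrt (g x).det

/-- Smooth symmetric 2-tensor fields with compact support in the interior of `H`. -/
structure IsTest (H : Set E3) (h : Tensor2) : Prop where
  symm : ∀ x i j, h x i j = h x j i
  smooth : ∀ i j, ContDiff ℝ ∞ (fun x => h x i j)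
  compact : HasCompactSupport h
  support : tsupport h ⊆ interior H

/-- `DΦ*_{(g,p)}(f, X) = (a, b)` on `H`, where `DΦ*` is the formal `L²`-adjoint: the two
`L²`-pairings agree against all smooth symmetric `(h, w)` with compact support in the interior. -/
def AdjointEq (H : Set E3) (g p : Tensor2) (f : H → ℝ) (X : H → Fin 3 → ℝ)
    (a b : H → Matrix (Fin 3) (Fin 3) ℝ) : Prop :=
  ∀ h w : Tensor2, IsTest H h → IsTest H w →
    ∫ x : H, (f x * (DPhi g p h w x).1 + inner1 g x (X x) (DPhi g p h w x).2) * volDensity g x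
        ∂(MeasureTheory.Measure.comap Subtype.val MeasureTheory.volume)
      = ∫ x : H, (inner2 g x (a x) (h x) + inner2 g x (b x) (w x)) * volDensity g x
        ∂(MeasureTheory.Measure.comap Subtype.val MeasureTheory.volume)

/-- Smoothness on `H` (up to whatever part of the boundary belongs to `H`). -/
def SmoothOn {F : Type} [NormedAddCommGroup F] [NormedSpace ℝ F] (H : Set E3) (u : H → F) :
    Prop :=
  ContDiffOn ℝ ∞ (Function.extend Subtype.val u 0) H

/-- The null space of `DΦ*_{(g,p)}` on smooth pairs (function, vector field) on `H`. -/
def kerAdjoint (H : Set E3) (g p : Tensor2) : Set ((H → ℝ) × (H → Fin 3 → ℝ)) :=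
  {q | SmoothOn H q.1 ∧ SmoothOn H q.2 ∧ AdjointEq H g p q.1 q.2 0 0}

/-- The spherical shell of points whose radius `r = ‖x‖` lies in `I`. -/
def shell (I : Set ℝ) : Set E3 := {x | ‖x‖ ∈ I}

/-- The metric `(1 - 2m/r)⁻¹ dr² + r² dσ²` in Cartesian coordinates: `dr` has components
`x_i / r`, and `r² dσ²` has components `δ_{ij} - (x_i / r) (x_j / r)`. -/
def schwarzschild (m : ℝ) : Tensor2 := fun x => Matrix.of fun i j =>
  (1 - 2 * m / ‖x‖)⁻¹ * ((x i / ‖x‖) * (x j / ‖x‖))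
    + ((if i = j then 1 else 0) - (x i / ‖x‖) * (x j / ‖x‖))

/-- The lapse `(1 - 2m/r)^{1/2}`. -/
def lapse (m : ℝ) (x : E3) : ℝ := Real.sqrt (1 - 2 * m / ‖x‖)

/-- The rotation field `x² ∂_3 - x³ ∂_2`. -/
def rot1 (x : E3) : Fin 3 → ℝ := ![0, -x 2, x 1]

/-- The rotation field `x³ ∂_1 - x¹ ∂_3`. -/
def rot2 (x : E3) : Fin 3 → ℝ := ![x 2, 0, -x 0]

/-- The rotation field `x¹ ∂_2 - x² ∂_1`. -/
def rot3 (x : E3) : Fin 3 → ℝ := ![-x 1, x 0, 0]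

end Constraint

end

open scoped ContDiff

noncomputable section

namespace Constraint

open MeasureTheory Topology

section

/-! ### Calculus of coordinate partial derivatives -/

/-! Since the background momentum vanishes, the linearized constraint map decouples into `DR(h)` and
`div ω`. Integrating by parts (`DPhi_pairing_eq_div`) and testing against arbitrary symmetric
tensors (`weak_iff_pointwise`) turns membership in the kernel into two independent pointwise systems
on the interior: `∇²f - (Δf) g - f Ric = 0` for `f`, and the Killing equation for `X`. The scalar
curvature is zero, so tracing the first system gives `Δf = 0`, hence `∇²f = f Ric`
(`staticUp_eq_zero_iff`).

Everything is computed in Cartesian coordinates, where the metric, its inverse, the Christoffel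
symbols and the Ricci tensor are combinations of `δ_ij` and `x_i x_j` with rational coefficients in
`r`.

Static potentials (`static_potential_eq`): the Hessian equation says `∂_a ∂_b f = P δ_ab + Q x_a
x_b`. Commuting third derivatives gives a Codazzi-type identity that forces `m ∇f` to be parallel to
`x`, so `∇f` is radial because `m ≠ 0`. The tangential part of the Hessian equation is then a
first-order radial equation, whose solutions are the multiples of the lapse.

Killing fields (`killing_eq`): the Euclidean radial component `ξ = x · X` satisfies `x · ∇ξ = κ ξ`
and `Δξ = Λ ξ`. Commuting the Laplacian with the Euler operator `x · ∇` leaves `-6m/r³ · ξ = 0`, so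
`ξ = 0` (`radial_component_eq_zero`). The Killing equation then loses all its Schwarzschild terms,
and a Euclidean Killing field tangent to the spheres is an infinitesimal rotation
(`euclidean_killing_tangent`).

These arguments run on the open connected shell over the interior of `I`. Continuity carries the
formulas to the boundary spheres that belong to the shell. -/

/-- `u` is differentiable at `x` with coordinate partial derivatives `D`. -/
structure HasGrad (u : E3 → ℝ) (D : Fin 3 → ℝ) (x : E3) : Prop where
  diff : DifferentiableAt ℝ u x
  pd_eq : ∀ i, pd i u x = D i

namespace HasGrad

variable {u v : E3 → ℝ} {D D' : Fin 3 → ℝ} {x : E3}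

theorem self (hu : DifferentiableAt ℝ u x) : HasGrad u (fun i => pd i u x) x :=
  ⟨hu, fun _ => rfl⟩

theorem congr_grad (hu : HasGrad u D x) (h : ∀ i, D i = D' i) : HasGrad u D' x :=
  ⟨hu.diff, fun i => (hu.pd_eq i).trans (h i)⟩

theorem congr (hu : HasGrad u D x) (h : v =ᶠ[𝓝 x] u) : HasGrad v D x :=
  ⟨hu.diff.congr_of_eventuallyEq h, fun i => by
    rw [← hu.pd_eq i, pd, pd, h.fderiv_eq]⟩

theorem const (c : ℝ) : HasGrad (fun _ => c) (fun _ => 0) x :=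
  ⟨differentiableAt_const c, fun i => by simp [pd]⟩

theorem coord (j : Fin 3) :
    HasGrad (fun y : E3 => y j) (fun i => if i = j then 1 else 0) x := by
  have h : HasFDerivAt (fun y : E3 => y j) (EuclideanSpace.proj j : E3 →L[ℝ] ℝ) x :=
    (EuclideanSpace.proj j : E3 →L[ℝ] ℝ).hasFDerivAt
  refine ⟨h.differentiableAt, fun i => ?_⟩
  rw [pd, h.fderiv]
  simp [eq_comm]

theorem add (hu : HasGrad u D x) (hv : HasGrad v D' x) :
    HasGrad (fun y => u y + v y) (fun i => D i + D' i) x :=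
  ⟨hu.diff.add hv.diff, fun i => by
    rw [← hu.pd_eq, ← hv.pd_eq, pd, pd, pd, fderiv_fun_add hu.diff hv.diff]; rfl⟩

theorem sub (hu : HasGrad u D x) (hv : HasGrad v D' x) :
    HasGrad (fun y => u y - v y) (fun i => D i - D' i) x :=
  ⟨hu.diff.sub hv.diff, fun i => by
    rw [← hu.pd_eq, ← hv.pd_eq, pd, pd, pd, fderiv_fun_sub hu.diff hv.diff]; rfl⟩

theorem mul (hu : HasGrad u D x) (hv : HasGrad v D' x) :
    HasGrad (fun y => u y * v y) (fun i => D i * v x + u x * D' i) x :=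
  ⟨hu.diff.mul hv.diff, fun i => by
    rw [← hu.pd_eq, ← hv.pd_eq, pd, pd, pd, fderiv_fun_mul hu.diff hv.diff]
    simp; ring⟩

theorem const_mul (c : ℝ) (hu : HasGrad u D x) :
    HasGrad (fun y => c * u y) (fun i => c * D i) x :=
  ((const c).mul hu).congr_grad fun i => by ring

theorem sum {ι : Type*} (s : Finset ι) {w : ι → E3 → ℝ} {d : ι → Fin 3 → ℝ}
    (h : ∀ a ∈ s, HasGrad (w a) (d a) x) :
    HasGrad (fun y => ∑ a ∈ s, w a y) (fun i => ∑ a ∈ s, d a i) x :=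
  ⟨DifferentiableAt.fun_sum fun a ha => (h a ha).diff, fun i => by
    rw [pd, fderiv_fun_sum fun a ha => (h a ha).diff, sum_apply]
    exact Finset.sum_congr rfl fun a ha => (h a ha).pd_eq i⟩

theorem radial {F : ℝ → ℝ} {F' : ℝ} (hx : x ≠ 0) (hF : HasDerivAt F F' ‖x‖) :
    HasGrad (fun y => F ‖y‖) (fun i => F' / ‖x‖ * x i) x := by
  have hn : HasFDerivAt (fun y : E3 => ‖y‖) (‖x‖⁻¹ • innerSL ℝ x) x := by
    have h1 := (hasStrictFDerivAt_norm_sq x).hasFDerivAt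
    have h2 := h1.sqrt (by positivity)
    simp only [Real.sqrt_sq (norm_nonneg _)] at h2
    have := norm_ne_zero_iff.2 hx
    rw [← Nat.cast_smul_eq_nsmul ℝ, smul_smul] at h2
    have e : ‖x‖⁻¹ = 1 / (2 * ‖x‖) * ((2 : ℕ) : ℝ) := by push_cast; field_simp
    rw [e]
    exact h2
  have h : HasFDerivAt (fun y : E3 => F ‖y‖) (F' • ‖x‖⁻¹ • innerSL ℝ x) x :=
    hF.comp_hasFDerivAt x hn
  refine ⟨h.differentiableAt, fun i => ?_⟩
  rw [pd, h.fderiv]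
  simp [innerSL_apply_apply, EuclideanSpace.inner_single_right]
  ring

end HasGrad

variable {U : Set E3} {u v : E3 → ℝ}

theorem differentiableAt_of_smooth (hU : IsOpen U) (hu : ContDiffOn ℝ ∞ u U) {x : E3}
    (hx : x ∈ U) : DifferentiableAt ℝ u x :=
  (hu.contDiffAt (hU.mem_nhds hx)).differentiableAt (by simp)

theorem hasGrad_of_smooth (hU : IsOpen U) (hu : ContDiffOn ℝ ∞ u U) {x : E3} (hx : x ∈ U) :
    HasGrad u (fun i => pd i u x) x :=
  HasGrad.self (differentiableAt_of_smooth hU hu hx)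

theorem smooth_pd (hU : IsOpen U) (hu : ContDiffOn ℝ ∞ u U) (i : Fin 3) :
    ContDiffOn ℝ ∞ (pd i u) U :=
  (hu.fderiv_of_isOpen hU (by simp)).clm_apply contDiffOn_const

theorem pd_congr (hU : IsOpen U) (h : ∀ y ∈ U, u y = v y) {x : E3} (hx : x ∈ U) (i : Fin 3) :
    pd i u x = pd i v x := by
  have : u =ᶠ[𝓝 x] v := Filter.eventually_of_mem (hU.mem_nhds hx) h
  rw [pd, pd, this.fderiv_eq]

theorem HasGrad.congr_on {D : Fin 3 → ℝ} {x : E3} (hu : HasGrad u D x) (hU : IsOpen U)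
    (hx : x ∈ U) (h : ∀ y ∈ U, v y = u y) : HasGrad v D x :=
  hu.congr (Filter.eventually_of_mem (hU.mem_nhds hx) h)

theorem pd_comm (hU : IsOpen U) (hu : ContDiffOn ℝ ∞ u U) {x : E3} (hx : x ∈ U)
    (i j : Fin 3) : pd i (pd j u) x = pd j (pd i u) x := by
  have hc : ContDiffAt ℝ ∞ u x := hu.contDiffAt (hU.mem_nhds hx)
  have hs : IsSymmSndFDerivAt ℝ u x := hc.isSymmSndFDerivAt
    (by simpa using (WithTop.coe_le_coe.2 le_top : (((2 : ℕ∞) : ℕ∞ω)) ≤ ∞))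
  have hd : DifferentiableAt ℝ (fderiv ℝ u) x :=
    (hc.fderiv_right (m := ∞) (by simp)).differentiableAt (by simp)
  have key : ∀ k l : Fin 3, pd k (pd l u) x =
      fderiv ℝ (fderiv ℝ u) x (EuclideanSpace.single k 1) (EuclideanSpace.single l 1) := by
    intro k l
    unfold pd
    rw [fderiv_clm_apply hd (differentiableAt_const _)]
    simp
  rw [key, key]
  exact hs _ _

theorem pd_eq_zero_of_compl {K : Set E3} (hK : IsClosed K) (h : ∀ y ∉ K, u y = 0) {x : E3}
    (hx : x ∉ K) (i : Fin 3) : pd i u x = 0 := by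
  rw [pd_congr hK.isOpen_compl (v := fun _ => 0) (fun y hy => h y hy) hx]
  simp [pd]

/-- Near a point of `K` smoothness comes from `U`, and elsewhere the function is locally zero. This
allows integration over all of space with coefficients controlled only on `U`. -/
theorem contDiff_of_compl {K : Set E3} {n : ℕ∞ω} (hU : IsOpen U) (hu : ContDiffOn ℝ n u U)
    (hK : IsClosed K) (hKU : K ⊆ U) (h : ∀ y ∉ K, u y = 0) : ContDiff ℝ n u := by
  rw [contDiff_iff_contDiffAt]
  intro x
  by_cases hx : x ∈ K
  · exact hu.contDiffAt (hU.mem_nhds (hKU hx))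
  · exact (contDiffAt_const (c := (0 : ℝ))).congr_of_eventuallyEq
      (Filter.eventually_of_mem (hK.isOpen_compl.mem_nhds hx) h)

theorem integrable_of_compl {K : Set E3} (hU : IsOpen U) (hu : ContDiffOn ℝ ∞ u U)
    (hK : IsCompact K) (hKU : K ⊆ U) (h : ∀ y ∉ K, u y = 0) : Integrable u :=
  (contDiff_of_compl hU hu hK.isClosed hKU h).continuous.integrable_of_hasCompactSupport
    (HasCompactSupport.intro hK fun x hx => h x hx)

theorem integral_pd_eq_zero {K : Set E3} (hU : IsOpen U) (hu : ContDiffOn ℝ ∞ u U)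
    (hK : IsCompact K) (hKU : K ⊆ U) (h : ∀ y ∉ K, u y = 0) (i : Fin 3) :
    ∫ x, pd i u x = 0 := by
  have hc := contDiff_of_compl hU hu hK.isClosed hKU h
  have hi := integrable_of_compl hU hu hK hKU h
  have hi' : Integrable (pd i u) := integrable_of_compl hU (smooth_pd hU hu i) hK hKU
    fun y hy => pd_eq_zero_of_compl hK.isClosed h hy i
  -- Integration by parts against the constant function 1; its product with `u` is integrable
  -- because `u` has compact support.
  have := integral_mul_fderiv_eq_neg_fderiv_mul_of_integrable (μ := (volume : Measure E3))
    (f := fun _ : E3 => (1 : ℝ)) (g := u) (v := EuclideanSpace.single i 1)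
    (by simp) (by simp only [one_mul]; exact hi') (by simpa using hi) (by simp)
    (fun x _ => hc.differentiable (by simp) x)
  simpa [pd] using this

theorem eq_const_of_pd_eq_zero (hU : IsOpen U) (hUc : IsPreconnected U)
    (hu : ContDiffOn ℝ ∞ u U) (h : ∀ x ∈ U, ∀ i, pd i u x = 0) :
    ∃ c, ∀ x ∈ U, u x = c := by
  refine hU.exists_is_const_of_fderiv_eq_zero hUc (hu.differentiableOn (by simp)) fun x hx => ?_
  ext w
  have hw : w = ∑ i, w i • EuclideanSpace.single i (1 : ℝ) := by
    ext j; fin_cases j <;> simp [Fin.sum_univ_three]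
  rw [hw, map_sum]
  simp only [map_smul]
  exact Finset.sum_eq_zero fun i _ => by
    have := h x hx i
    rw [pd] at this
    simp [this]

theorem norm_sq_eq_sum (x : E3) : ‖x‖ ^ 2 = x 0 ^ 2 + x 1 ^ 2 + x 2 ^ 2 := by
  rw [EuclideanSpace.norm_sq_eq]; simp [Fin.sum_univ_three]

end

section

/-! ### The Schwarzschild metric in Cartesian coordinates -/

/-- The Kronecker delta. -/
def kd (i j : Fin 3) : ℝ := if i = j then 1 else 0

theorem kd_comm (i j : Fin 3) : kd i j = kd j i := by
  unfold kd; simp only [eq_comm]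

@[simp] theorem sum_kd_mul (i : Fin 3) (a : Fin 3 → ℝ) : ∑ l, kd i l * a l = a i := by
  simp [kd]

@[simp] theorem sum_mul_kd (i : Fin 3) (a : Fin 3 → ℝ) : ∑ l, a l * kd i l = a i := by
  simp [kd]

theorem sum_coord_mul_self (x : E3) : ∑ l, x l * x l = ‖x‖ ^ 2 := by
  rw [norm_sq_eq_sum, Fin.sum_univ_three]; ring

theorem hasGrad_coord (j : Fin 3) (x : E3) :
    HasGrad (fun y : E3 => y j) (fun i => kd i j) x := HasGrad.coord j

/-- The region outside the horizon and the origin. -/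
def exterior (m : ℝ) : Set E3 := {x | 0 < ‖x‖ ∧ 2 * m < ‖x‖}

theorem isOpen_exterior (m : ℝ) : IsOpen (exterior m) :=
  (isOpen_lt continuous_const continuous_norm).inter (isOpen_lt continuous_const continuous_norm)

variable {m : ℝ} {x : E3}

theorem ne_zero_of_mem_exterior (hx : x ∈ exterior m) : x ≠ 0 := norm_pos_iff.1 hx.1

theorem norm_ne_zero_of_mem_exterior (hx : x ∈ exterior m) : ‖x‖ ≠ 0 := hx.1.ne'

theorem norm_sub_ne_zero_of_mem_exterior (hx : x ∈ exterior m) : ‖x‖ - 2 * m ≠ 0 :=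
  (sub_pos.2 hx.2).ne'

theorem norm_smooth : ContDiffOn ℝ ∞ (fun y : E3 => ‖y‖) (exterior m) :=
  fun _ hx => (contDiffAt_norm ℝ (ne_zero_of_mem_exterior hx)).contDiffWithinAt

theorem coord_smooth (U : Set E3) (i : Fin 3) : ContDiffOn ℝ ∞ (fun y : E3 => y i) U :=
  (EuclideanSpace.proj i : E3 →L[ℝ] ℝ).contDiff.contDiffOn

/-- `g^{ij} = δ_{ij} - φ x_i x_j`. -/
def schwPhi (m r : ℝ) : ℝ := 2 * m / r ^ 3
/-- `g_{ij} = δ_{ij} + ψ x_i x_j`. -/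
def schwPsi (m r : ℝ) : ℝ := 2 * m / (r ^ 2 * (r - 2 * m))
/-- The function `ψ' / r`. -/
def schwPsi' (m r : ℝ) : ℝ := -(2 * m * (3 * r - 4 * m)) / (r ^ 4 * (r - 2 * m) ^ 2)
/-- `Γ^k_{ij} = x_k (A x_i x_j + φ δ_{ij})`. -/
def schwA (m r : ℝ) : ℝ := -(m * (3 * r - 4 * m)) / (r ^ 5 * (r - 2 * m))
/-- The function `A' / r`. -/
def schwA' (m r : ℝ) : ℝ :=
  m * (15 * r ^ 2 - 48 * m * r + 40 * m ^ 2) / (r ^ 7 * (r - 2 * m) ^ 2)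
/-- `Ric_{ij} = α δ_{ij} + β x_i x_j`. -/
def schwAlpha (m r : ℝ) : ℝ := m / r ^ 3
/-- `Ric_{ij} = α δ_{ij} + β x_i x_j`. -/
def schwBeta (m r : ℝ) : ℝ := -(m * (3 * r - 2 * m)) / (r ^ 5 * (r - 2 * m))

theorem schwPhi_smooth : ContDiffOn ℝ ∞ (fun y => schwPhi m ‖y‖) (exterior m) :=
  contDiffOn_const.div (norm_smooth.pow 3)
    fun _ hx => pow_ne_zero _ (norm_ne_zero_of_mem_exterior hx)

theorem schwPsi_smooth : ContDiffOn ℝ ∞ (fun y => schwPsi m ‖y‖) (exterior m) :=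
  contDiffOn_const.div ((norm_smooth.pow 2).mul (norm_smooth.sub contDiffOn_const))
    fun _ hx => mul_ne_zero (pow_ne_zero _ (norm_ne_zero_of_mem_exterior hx))
      (norm_sub_ne_zero_of_mem_exterior hx)

theorem schwA_smooth : ContDiffOn ℝ ∞ (fun y => schwA m ‖y‖) (exterior m) :=
  ((contDiffOn_const.mul ((contDiffOn_const.mul norm_smooth).sub contDiffOn_const)).neg).div
    ((norm_smooth.pow 5).mul (norm_smooth.sub contDiffOn_const))
    fun _ hx => mul_ne_zero (pow_ne_zero _ (norm_ne_zero_of_mem_exterior hx))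
      (norm_sub_ne_zero_of_mem_exterior hx)

theorem hasGrad_schwPhi (hx : x ∈ exterior m) :
    HasGrad (fun y => schwPhi m ‖y‖) (fun i => -6 * m / ‖x‖ ^ 5 * x i) x := by
  have h0 := norm_ne_zero_of_mem_exterior hx
  have h : HasDerivAt (schwPhi m) _ ‖x‖ :=
    (hasDerivAt_const ‖x‖ (2 * m)).div ((hasDerivAt_id ‖x‖).pow 3) (pow_ne_zero 3 h0)
  refine (HasGrad.radial (ne_zero_of_mem_exterior hx) h).congr_grad fun i => ?_
  simp only [id]
  push_cast
  field_simp
  ring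

theorem hasGrad_schwPsi (hx : x ∈ exterior m) :
    HasGrad (fun y => schwPsi m ‖y‖) (fun i => schwPsi' m ‖x‖ * x i) x := by
  have h0 := norm_ne_zero_of_mem_exterior hx
  have h1 := norm_sub_ne_zero_of_mem_exterior hx
  have h : HasDerivAt (schwPsi m) _ ‖x‖ :=
    (hasDerivAt_const ‖x‖ (2 * m)).div
      (((hasDerivAt_id ‖x‖).pow 2).mul ((hasDerivAt_id ‖x‖).sub_const (2 * m)))
      (mul_ne_zero (pow_ne_zero 2 h0) h1)
  refine (HasGrad.radial (ne_zero_of_mem_exterior hx) h).congr_grad fun i => ?_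
  simp only [id, Pi.pow_apply, schwPsi']
  push_cast
  field_simp
  ring

theorem hasGrad_schwA (hx : x ∈ exterior m) :
    HasGrad (fun y => schwA m ‖y‖) (fun i => schwA' m ‖x‖ * x i) x := by
  have h0 := norm_ne_zero_of_mem_exterior hx
  have h1 := norm_sub_ne_zero_of_mem_exterior hx
  have h : HasDerivAt (schwA m) _ ‖x‖ :=
    ((((hasDerivAt_id ‖x‖).const_mul 3).sub_const (4 * m)).const_mul m).neg.div
      (((hasDerivAt_id ‖x‖).pow 5).mul ((hasDerivAt_id ‖x‖).sub_const (2 * m)))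
      (mul_ne_zero (pow_ne_zero 5 h0) h1)
  refine (HasGrad.radial (ne_zero_of_mem_exterior hx) h).congr_grad fun i => ?_
  simp only [id, Pi.pow_apply, Pi.neg_apply, schwA']
  push_cast
  field_simp
  ring

theorem schwarzschild_apply (hx : x ∈ exterior m) (i j : Fin 3) :
    schwarzschild m x i j = kd i j + schwPsi m ‖x‖ * (x i * x j) := by
  have h0 := norm_ne_zero_of_mem_exterior hx
  have h1 := norm_sub_ne_zero_of_mem_exterior hx
  have h2 : (1 - 2 * m / ‖x‖)⁻¹ = ‖x‖ / (‖x‖ - 2 * m) := by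
    rw [inv_eq_one_div, one_sub_div h0, one_div_div]
  simp only [schwarzschild, Matrix.of_apply, kd, schwPsi, h2]
  field_simp
  ring

/-- The Sherman–Morrison relation: this scalar is the only obstruction to `δ - φ x xᵀ` inverting `δ
+ ψ x xᵀ`. -/
theorem schwPsi_sub_schwPhi (hx : x ∈ exterior m) :
    schwPsi m ‖x‖ - schwPhi m ‖x‖ - schwPsi m ‖x‖ * schwPhi m ‖x‖ * ‖x‖ ^ 2 = 0 := by
  have h0 := norm_ne_zero_of_mem_exterior hx
  have h1 := norm_sub_ne_zero_of_mem_exterior hx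
  simp only [schwPsi, schwPhi]
  field_simp
  ring

theorem sum_rank_one_mul (p q : ℝ) (v : Fin 3 → ℝ) (i j : Fin 3) :
    ∑ k, (kd i k + p * (v i * v k)) * (kd k j - q * (v k * v j)) =
      kd i j + (p - q - p * q * ∑ k, v k * v k) * (v i * v j) := by
  simp only [Fin.sum_univ_three]
  fin_cases i <;> fin_cases j <;> simp [kd] <;> ring

theorem schwarzschild_inv (hx : x ∈ exterior m) :
    (schwarzschild m x)⁻¹ = Matrix.of fun i j => kd i j - schwPhi m ‖x‖ * (x i * x j) := by
  refine Matrix.inv_eq_right_inv ?_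
  ext i j
  simp only [Matrix.mul_apply, schwarzschild_apply hx, Matrix.of_apply]
  rw [sum_rank_one_mul, sum_coord_mul_self, schwPsi_sub_schwPhi hx, zero_mul, add_zero]
  simp [kd, Matrix.one_apply]

theorem ginv_schwarzschild (hx : x ∈ exterior m) (i j : Fin 3) :
    ginv (schwarzschild m) x i j = kd i j - schwPhi m ‖x‖ * (x i * x j) := by
  rw [ginv, schwarzschild_inv hx, Matrix.of_apply]

theorem det_schwarzschild (hx : x ∈ exterior m) :
    (schwarzschild m x).det = ‖x‖ / (‖x‖ - 2 * m) := by
  have h0 := norm_ne_zero_of_mem_exterior hx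
  have h1 := norm_sub_ne_zero_of_mem_exterior hx
  have h2 : (schwarzschild m x).det = 1 + schwPsi m ‖x‖ * ‖x‖ ^ 2 := by
    rw [norm_sq_eq_sum, Matrix.det_fin_three]
    simp [schwarzschild_apply hx, kd]
    ring
  rw [h2, schwPsi]
  field_simp
  ring

theorem hasGrad_schwarzschild (hx : x ∈ exterior m) (i j : Fin 3) :
    HasGrad (fun y => schwarzschild m y i j)
      (fun k => schwPsi' m ‖x‖ * (x k * x i * x j)
        + schwPsi m ‖x‖ * (kd k i * x j + kd k j * x i)) x := by
  refine (((HasGrad.const (kd i j)).add ((hasGrad_schwPsi hx).mul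
    ((hasGrad_coord i x).mul (hasGrad_coord j x)))).congr_on (isOpen_exterior m) hx
    fun y hy => schwarzschild_apply hy i j).congr_grad fun k => ?_
  ring

theorem schwarzschild_smooth (i j : Fin 3) :
    ContDiffOn ℝ ∞ (fun y => schwarzschild m y i j) (exterior m) :=
  (contDiffOn_const.add (schwPsi_smooth.mul ((coord_smooth _ i).mul (coord_smooth _ j)))).congr
    fun _ hy => schwarzschild_apply hy i j

theorem schwarzschild_symm (x : E3) (i j : Fin 3) :
    schwarzschild m x i j = schwarzschild m x j i := by
  simp only [schwarzschild, Matrix.of_apply, eq_comm (a := i) (b := j)]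
  ring

theorem ginv_schwarzschild_symm (hx : x ∈ exterior m) (i j : Fin 3) :
    ginv (schwarzschild m) x i j = ginv (schwarzschild m) x j i := by
  rw [ginv_schwarzschild hx, ginv_schwarzschild hx, kd_comm]
  ring

theorem ginv_schwarzschild_smooth (i j : Fin 3) :
    ContDiffOn ℝ ∞ (fun y => ginv (schwarzschild m) y i j) (exterior m) :=
  (contDiffOn_const.sub (schwPhi_smooth.mul ((coord_smooth _ i).mul (coord_smooth _ j)))).congr
    fun _ hy => ginv_schwarzschild hy i j

theorem schwA_eq (hx : x ∈ exterior m) :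
    schwA m ‖x‖ = (1 - schwPhi m ‖x‖ * ‖x‖ ^ 2) * (schwPsi' m ‖x‖ / 2) := by
  have h0 := norm_ne_zero_of_mem_exterior hx
  have h1 := norm_sub_ne_zero_of_mem_exterior hx
  simp only [schwA, schwPhi, schwPsi']
  field_simp

theorem christoffel_schwarzschild (hx : x ∈ exterior m) (k i j : Fin 3) :
    christoffel (schwarzschild m) k i j x =
      x k * (schwA m ‖x‖ * (x i * x j) + schwPhi m ‖x‖ * kd i j) := by
  have hz := schwPsi_sub_schwPhi hx
  have key : ∀ l, ginv (schwarzschild m) x k l *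
      (pd i (fun y => schwarzschild m y j l) x + pd j (fun y => schwarzschild m y i l) x
        - pd l (fun y => schwarzschild m y i j) x)
      = (kd k l * x l - schwPhi m ‖x‖ * x k * (x l * x l)) *
        (schwPsi' m ‖x‖ * (x i * x j) + 2 * schwPsi m ‖x‖ * kd i j) := by
    intro l
    rw [(hasGrad_schwarzschild hx j l).pd_eq, (hasGrad_schwarzschild hx i l).pd_eq,
      (hasGrad_schwarzschild hx i j).pd_eq, ginv_schwarzschild hx, kd_comm j i, kd_comm l i,
      kd_comm l j]
    ring
  rw [christoffel, Finset.sum_congr rfl fun l _ => key l, ← Finset.sum_mul,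
    Finset.sum_sub_distrib, sum_kd_mul, ← Finset.mul_sum, sum_coord_mul_self, schwA_eq hx]
  linear_combination (x k * kd i j) * hz

theorem christoffel_schwarzschild_symm (hx : x ∈ exterior m) (k i j : Fin 3) :
    christoffel (schwarzschild m) k i j x = christoffel (schwarzschild m) k j i x := by
  rw [christoffel_schwarzschild hx, christoffel_schwarzschild hx, kd_comm]
  ring

theorem christoffel_schwarzschild_smooth (k i j : Fin 3) :
    ContDiffOn ℝ ∞ (christoffel (schwarzschild m) k i j) (exterior m) :=
  ((coord_smooth _ k).mul ((schwA_smooth.mul ((coord_smooth _ i).mul (coord_smooth _ j))).add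
    (schwPhi_smooth.mul contDiffOn_const))).congr fun _ hy => christoffel_schwarzschild hy k i j

theorem hasGrad_christoffel_schwarzschild (hx : x ∈ exterior m) (k i j : Fin 3) :
    HasGrad (christoffel (schwarzschild m) k i j)
      (fun n => kd n k * (schwA m ‖x‖ * (x i * x j) + schwPhi m ‖x‖ * kd i j)
        + x k * (schwA' m ‖x‖ * (x n * x i * x j) + schwA m ‖x‖ * (kd n i * x j + kd n j * x i)
          + -6 * m / ‖x‖ ^ 5 * x n * kd i j)) x := by
  refine (((hasGrad_coord k x).mul (((hasGrad_schwA hx).mul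
    ((hasGrad_coord i x).mul (hasGrad_coord j x))).add
    ((hasGrad_schwPhi hx).mul (HasGrad.const (kd i j))))).congr_on (isOpen_exterior m) hx
    fun y hy => christoffel_schwarzschild hy k i j).congr_grad fun n => ?_
  ring

/-- Metric compatibility `∇g⁻¹ = 0`, checked on the closed forms. It reduces to one scalar identity
for `φ'/r`, the `hz` below. -/
theorem pd_ginv_schwarzschild (hx : x ∈ exterior m) (k i j : Fin 3) :
    pd k (fun y => ginv (schwarzschild m) y i j) x =
      -∑ l, (christoffel (schwarzschild m) i k l x * ginv (schwarzschild m) x l j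
        + christoffel (schwarzschild m) j k l x * ginv (schwarzschild m) x i l) := by
  have h0 := norm_ne_zero_of_mem_exterior hx
  have h1 := norm_sub_ne_zero_of_mem_exterior hx
  have h1' : ‖x‖ - m * 2 ≠ 0 := mul_comm 2 m ▸ h1
  have hg : HasGrad (fun y => ginv (schwarzschild m) y i j) _ x :=
    ((HasGrad.const (kd i j)).sub ((hasGrad_schwPhi hx).mul
      ((hasGrad_coord i x).mul (hasGrad_coord j x)))).congr_on (isOpen_exterior m) hx
      fun y hy => ginv_schwarzschild hy i j
  have hz : -6 * m / ‖x‖ ^ 5 =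
      2 * schwA m ‖x‖ * (1 - schwPhi m ‖x‖ * ‖x‖ ^ 2) - 2 * schwPhi m ‖x‖ ^ 2 := by
    simp only [schwA, schwPhi]
    field_simp
    ring
  rw [hg.pd_eq, hz, norm_sq_eq_sum]
  simp only [christoffel_schwarzschild hx, ginv_schwarzschild hx, Fin.sum_univ_three]
  generalize schwA m ‖x‖ = A
  generalize schwPhi m ‖x‖ = φ
  fin_cases k <;> fin_cases i <;> fin_cases j <;> simp [kd] <;> ring

theorem ricci_schwarzschild (hx : x ∈ exterior m) (i j : Fin 3) :
    ricci (schwarzschild m) x i j = schwAlpha m ‖x‖ * kd i j + schwBeta m ‖x‖ * (x i * x j) := by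
  have h0 := norm_ne_zero_of_mem_exterior hx
  have h1 := norm_sub_ne_zero_of_mem_exterior hx
  have h1' : ‖x‖ - m * 2 ≠ 0 := mul_comm 2 m ▸ h1
  have ha : schwAlpha m ‖x‖ = 2 * schwPhi m ‖x‖ + ‖x‖ ^ 2 * (-6 * m / ‖x‖ ^ 5)
      - schwA m ‖x‖ * ‖x‖ ^ 2 + ‖x‖ ^ 2 * schwPhi m ‖x‖ *
        (schwA m ‖x‖ * ‖x‖ ^ 2 + schwPhi m ‖x‖) := by
    simp only [schwA, schwPhi, schwAlpha]
    field_simp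
    ring
  have hb : schwBeta m ‖x‖ = 3 * schwA m ‖x‖ - (-6 * m / ‖x‖ ^ 5)
      - schwPhi m ‖x‖ * (schwA m ‖x‖ * ‖x‖ ^ 2 + schwPhi m ‖x‖) := by
    simp only [schwA, schwPhi, schwBeta]
    field_simp
    ring
  rw [ha, hb, ricci]
  simp only [(hasGrad_christoffel_schwarzschild hx _ _ _).pd_eq, christoffel_schwarzschild hx,
    Fin.sum_univ_three]
  generalize -6 * m / ‖x‖ ^ 5 = φ'
  generalize schwA m ‖x‖ = A
  -- `A'` may stay arbitrary: its contributions `r² A' x_i x_j` to `∂_k Γ^k_ij` and `∂_j Γ^k_ik`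
  -- cancel.
  generalize schwA' m ‖x‖ = A'
  generalize schwPhi m ‖x‖ = φ
  rw [norm_sq_eq_sum]
  fin_cases i <;> fin_cases j <;> simp [kd] <;> ring

theorem volDensity_schwarzschild (hx : x ∈ exterior m) :
    volDensity (schwarzschild m) x = Real.sqrt (‖x‖ / (‖x‖ - 2 * m)) := by
  rw [volDensity, det_schwarzschild hx]

theorem div_pos_of_mem_exterior (hx : x ∈ exterior m) : 0 < ‖x‖ / (‖x‖ - 2 * m) :=
  div_pos hx.1 (sub_pos.2 hx.2)

theorem volDensity_schwarzschild_pos (hx : x ∈ exterior m) :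
    0 < volDensity (schwarzschild m) x := by
  rw [volDensity_schwarzschild hx]
  exact Real.sqrt_pos.2 (div_pos_of_mem_exterior hx)

theorem volDensity_schwarzschild_smooth :
    ContDiffOn ℝ ∞ (volDensity (schwarzschild m)) (exterior m) :=
  ((norm_smooth.div (norm_smooth.sub contDiffOn_const)
    fun _ hy => norm_sub_ne_zero_of_mem_exterior hy).sqrt
    fun _ hy => (div_pos_of_mem_exterior hy).ne').congr fun _ hy => volDensity_schwarzschild hy

theorem sum_christoffel_trace (hx : x ∈ exterior m) (k : Fin 3) :
    ∑ l, christoffel (schwarzschild m) l k l x = -(schwPsi m ‖x‖ / 2) * x k := by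
  have h0 := norm_ne_zero_of_mem_exterior hx
  have h1 := norm_sub_ne_zero_of_mem_exterior hx
  have h1' : ‖x‖ - m * 2 ≠ 0 := mul_comm 2 m ▸ h1
  have : ∀ l, christoffel (schwarzschild m) l k l x =
      schwA m ‖x‖ * x k * (x l * x l) + schwPhi m ‖x‖ * (x l * kd k l) := by
    intro l; rw [christoffel_schwarzschild hx]; ring
  rw [Finset.sum_congr rfl fun l _ => this l, Finset.sum_add_distrib, ← Finset.mul_sum,
    ← Finset.mul_sum, sum_mul_kd, sum_coord_mul_self, schwA, schwPhi, schwPsi]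
  field_simp
  ring

/-- The identity `∂_k log √det g = Γ^l_kl`. It makes `√g ∇_k V^k` the coordinate divergence `∂_k(√g
V^k)`, whose integral vanishes for compact support. -/
theorem pd_volDensity_schwarzschild (hx : x ∈ exterior m) (k : Fin 3) :
    pd k (volDensity (schwarzschild m)) x =
      volDensity (schwarzschild m) x * ∑ l, christoffel (schwarzschild m) l k l x := by
  have h0 := norm_ne_zero_of_mem_exterior hx
  have h1 := norm_sub_ne_zero_of_mem_exterior hx
  have h1' : ‖x‖ - m * 2 ≠ 0 := mul_comm 2 m ▸ h1
  have hp := div_pos_of_mem_exterior hx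
  have hd : HasDerivAt (fun r : ℝ => Real.sqrt (r / (r - 2 * m)))
      ((1 * (‖x‖ - 2 * m) - ‖x‖ * 1) / (‖x‖ - 2 * m) ^ 2 /
        (2 * Real.sqrt (‖x‖ / (‖x‖ - 2 * m)))) ‖x‖ :=
    ((hasDerivAt_id ‖x‖).div ((hasDerivAt_id ‖x‖).sub_const (2 * m)) h1).sqrt hp.ne'
  have hg := (HasGrad.radial (ne_zero_of_mem_exterior hx) hd).congr_on (isOpen_exterior m) hx
    fun y hy => volDensity_schwarzschild hy
  rw [hg.pd_eq, sum_christoffel_trace hx, volDensity_schwarzschild hx, schwPsi]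
  have hq := (Real.sqrt_pos.2 hp).ne'
  have hqq := Real.sq_sqrt hp.le
  generalize Real.sqrt (‖x‖ / (‖x‖ - 2 * m)) = q at *
  have e : q⁻¹ = q * ((‖x‖ - 2 * m) / ‖x‖) := by
    rw [← inv_div, ← hqq]; field_simp
  rw [div_eq_mul_inv _ (2 * q), mul_inv, e]
  field_simp
  ring

end

section

/-! ### First variation of the curvature and of the constraint map -/

/-- `g` is a smooth pseudo-Riemannian metric on the open set `U`. -/
structure IsMetricOn (g : Tensor2) (U : Set E3) : Prop where
  isOpen : IsOpen U
  smooth : ∀ i j, ContDiffOn ℝ ∞ (fun x => g x i j) U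
  symm : ∀ x ∈ U, ∀ i j, g x i j = g x j i
  det_ne : ∀ x ∈ U, (g x).det ≠ 0

/-- Smooth symmetric 2-tensor fields. -/
structure IsSmoothSymm (h : Tensor2) : Prop where
  smooth : ∀ i j, ContDiff ℝ ∞ (fun x => h x i j)
  symm : ∀ x i j, h x i j = h x j i

theorem IsTest.isSmoothSymm {H : Set E3} {h : Tensor2} (hh : IsTest H h) : IsSmoothSymm h :=
  ⟨hh.smooth, hh.symm⟩

theorem isMetricOn_schwarzschild (m : ℝ) : IsMetricOn (schwarzschild m) (exterior m) where
  isOpen := isOpen_exterior m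
  smooth := schwarzschild_smooth
  symm := fun x _ => schwarzschild_symm x
  det_ne := fun x hx => by rw [det_schwarzschild hx]; exact (div_pos_of_mem_exterior hx).ne'

/-- Both sides are mixed second derivatives of `F` on the product space, in the directions `(1, 0)`
and `(0, e_k)`, so symmetry of the second Fréchet derivative identifies them. -/
theorem hasDerivAt_pd_of_contDiffAt {F : ℝ × E3 → ℝ} {x : E3} (hF : ContDiffAt ℝ ∞ F (0, x))
    (k : Fin 3) :
    HasDerivAt (fun t => pd k (fun y => F (t, y)) x)
      (pd k (fun y => deriv (fun t => F (t, y)) 0) x) 0 := by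
  have hs : IsSymmSndFDerivAt ℝ F (0, x) := hF.isSymmSndFDerivAt
    (by simpa using (WithTop.coe_le_coe.2 le_top : (((2 : ℕ∞) : ℕ∞ω)) ≤ ∞))
  have hd : DifferentiableAt ℝ (fderiv ℝ F) (0, x) :=
    (hF.fderiv_right (m := ∞) (by simp)).differentiableAt (by simp)
  have hev : ∀ᶠ q in 𝓝 ((0 : ℝ), x), DifferentiableAt ℝ F q := by
    have h1 : ContDiffAt ℝ 1 F (0, x) := hF.of_le (by simp)
    filter_upwards [h1.eventually (by simp)] with q hq
    exact hq.differentiableAt (by simp)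
  have hE : HasFDerivAt (fun y : E3 => ((0 : ℝ), y)) (ContinuousLinearMap.inr ℝ ℝ E3) x :=
    (ContinuousLinearMap.inr ℝ ℝ E3).hasFDerivAt
  have hT : HasDerivAt (fun t : ℝ => (t, x)) ((1 : ℝ), (0 : E3)) 0 :=
    (hasDerivAt_id (0 : ℝ)).prodMk (hasDerivAt_const 0 x)
  have ev1 : (fun t => pd k (fun y => F (t, y)) x) =ᶠ[𝓝 0]
      fun t => fderiv ℝ F (t, x) (0, EuclideanSpace.single k 1) := by
    have : Filter.Tendsto (fun t : ℝ => (t, x)) (𝓝 0) (𝓝 (0, x)) := hT.continuousAt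
    filter_upwards [this.eventually hev] with t ht
    have hy : HasFDerivAt (fun y : E3 => (t, y)) (ContinuousLinearMap.inr ℝ ℝ E3) x :=
      (hasFDerivAt_const t x).prodMk (hasFDerivAt_id x)
    have := HasFDerivAt.comp x ht.hasFDerivAt hy
    unfold pd
    rw [show (fun y => F (t, y)) = F ∘ fun y : E3 => (t, y) from rfl, this.fderiv]
    simp
  have ev2 : (fun y => deriv (fun t => F (t, y)) 0) =ᶠ[𝓝 x]
      fun y => fderiv ℝ F (0, y) (1, 0) := by
    have : Filter.Tendsto (fun y : E3 => ((0 : ℝ), y)) (𝓝 x) (𝓝 (0, x)) := hE.continuousAt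
    filter_upwards [this.eventually hev] with y hy
    have ht : HasDerivAt (fun t : ℝ => (t, y)) ((1 : ℝ), (0 : E3)) 0 :=
      (hasDerivAt_id (0 : ℝ)).prodMk (hasDerivAt_const 0 y)
    exact (hy.hasFDerivAt.comp_hasDerivAt (0 : ℝ) ht).deriv
  have hL : HasDerivAt (fun t => fderiv ℝ F (t, x) (0, EuclideanSpace.single k 1))
      (fderiv ℝ (fderiv ℝ F) (0, x) (1, 0) (0, EuclideanSpace.single k 1)) 0 := by
    have := hd.hasFDerivAt.comp_hasDerivAt (0 : ℝ) hT
    simpa using this.clm_apply (hasDerivAt_const (0 : ℝ) ((0 : ℝ), EuclideanSpace.single k (1 : ℝ)))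
  have hR : pd k (fun y => deriv (fun t => F (t, y)) 0) x =
      fderiv ℝ (fderiv ℝ F) (0, x) (0, EuclideanSpace.single k 1) (1, 0) := by
    have h1 := (hd.hasFDerivAt.comp x hE).clm_apply (hasFDerivAt_const ((1 : ℝ), (0 : E3)) x)
    rw [pd, ev2.fderiv_eq]
    have h2 : fderiv ℝ (fun y => fderiv ℝ F (0, y) (1, 0)) x = _ := h1.fderiv
    rw [h2]
    simp
  rw [hR, hs]
  exact hL.congr_of_eventuallyEq ev1

theorem contDiffAt_det {E : Type*} [NormedAddCommGroup E] [NormedSpace ℝ E]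
    {M : E → Matrix (Fin 3) (Fin 3) ℝ} {q : E} (hM : ∀ i j, ContDiffAt ℝ ∞ (fun z => M z i j) q) :
    ContDiffAt ℝ ∞ (fun z => (M z).det) q := by
  simp only [Matrix.det_fin_three]
  fun_prop

theorem contDiffAt_inv {E : Type*} [NormedAddCommGroup E] [NormedSpace ℝ E]
    {M : E → Matrix (Fin 3) (Fin 3) ℝ} {q : E} (hM : ∀ i j, ContDiffAt ℝ ∞ (fun z => M z i j) q)
    (h0 : (M q).det ≠ 0) (i j : Fin 3) : ContDiffAt ℝ ∞ (fun z => (M z)⁻¹ i j) q := by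
  simp only [Matrix.inv_def, Ring.inverse_eq_inv', Matrix.smul_apply, smul_eq_mul,
    Matrix.adjugate_apply]
  refine ((contDiffAt_det hM).inv h0).mul (contDiffAt_det fun a b => ?_)
  by_cases hab : a = j
  · subst hab; simpa using contDiffAt_const
  · simpa [Matrix.updateRow_apply, hab] using hM a b

/-- Terms of the constraint map carrying a factor `t` are differentiated at 0 without computing the
derivative of the cofactor. -/
theorem hasDerivAt_id_mul {q : ℝ → ℝ} (hq : DifferentiableAt ℝ q 0) :
    HasDerivAt (fun t => t * q t) (q 0) 0 := by
  simpa using (hasDerivAt_id' (0 : ℝ)).fun_mul hq.hasDerivAt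

variable {g h w : Tensor2} {U : Set E3} {x : E3}

theorem add_smul_apply (g h : Tensor2) (t : ℝ) (y : E3) (i j : Fin 3) :
    (g + t • h) y i j = g y i j + t * h y i j := rfl

theorem contDiffAt_ginv_add_smul (hg : IsMetricOn g U) (hh : IsSmoothSymm h) (hx : x ∈ U)
    (i j : Fin 3) :
    ContDiffAt ℝ ∞ (fun q : ℝ × E3 => ginv (g + q.1 • h) q.2 i j) (0, x) := by
  refine contDiffAt_inv (M := fun q : ℝ × E3 => (g + q.1 • h) q.2) (fun a b => ?_) ?_ i j
  · simp only [add_smul_apply]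
    have h1 : ContDiffAt ℝ ∞ (fun q : ℝ × E3 => g q.2 a b) (0, x) :=
      ((hg.smooth a b).contDiffAt (hg.isOpen.mem_nhds hx)).comp ((0 : ℝ), x) contDiffAt_snd
    have h2 : ContDiffAt ℝ ∞ (fun q : ℝ × E3 => h q.2 a b) (0, x) :=
      (hh.smooth a b).contDiffAt.comp ((0 : ℝ), x) contDiffAt_snd
    exact h1.add (contDiffAt_fst.mul h2)
  · simpa using hg.det_ne x hx

theorem pd_add_smul (hg : IsMetricOn g U) (hh : IsSmoothSymm h) (hx : x ∈ U) (t : ℝ)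
    (k i j : Fin 3) : pd k (fun y => (g + t • h) y i j) x =
      pd k (fun y => g y i j) x + t * pd k (fun y => h y i j) x := by
  simp only [add_smul_apply]
  exact ((hasGrad_of_smooth hg.isOpen (hg.smooth i j) hx).add
    ((HasGrad.self ((hh.smooth i j).differentiable (by simp) x)).const_mul t)).pd_eq k

theorem contDiffAt_christoffel_add_smul (hg : IsMetricOn g U) (hh : IsSmoothSymm h) (hx : x ∈ U)
    (k i j : Fin 3) :
    ContDiffAt ℝ ∞ (fun q : ℝ × E3 => christoffel (g + q.1 • h) k i j q.2) (0, x) := by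
  have hp : ∀ a b c, ContDiffAt ℝ ∞
      (fun q : ℝ × E3 => pd a (fun y => (g + q.1 • h) y b c) q.2) (0, x) := by
    intro a b c
    have h1 : ContDiffAt ℝ ∞ (fun q : ℝ × E3 => pd a (fun y => g y b c) q.2) (0, x) :=
      ((smooth_pd hg.isOpen (hg.smooth b c) a).contDiffAt (hg.isOpen.mem_nhds hx)).comp
        ((0 : ℝ), x) contDiffAt_snd
    have h2 : ContDiffAt ℝ ∞ (fun q : ℝ × E3 => pd a (fun y => h y b c) q.2) (0, x) :=
      ((smooth_pd isOpen_univ (hh.smooth b c).contDiffOn a).contDiffAt Filter.univ_mem).comp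
        ((0 : ℝ), x) contDiffAt_snd
    refine (h1.add (contDiffAt_fst.mul h2)).congr_of_eventuallyEq ?_
    have : ∀ᶠ q : ℝ × E3 in 𝓝 (0, x), q.2 ∈ U :=
      continuous_snd.continuousAt.eventually_mem (hg.isOpen.mem_nhds hx)
    filter_upwards [this] with q hq
    exact pd_add_smul hg hh hq q.1 a b c
  unfold christoffel
  exact contDiffAt_const.mul (ContDiffAt.sum fun l _ =>
    (contDiffAt_ginv_add_smul hg hh hx k l).mul (((hp i j l).add (hp j i l)).sub (hp l i j)))

theorem differentiableAt_ginv_add_smul (hg : IsMetricOn g U) (hh : IsSmoothSymm h) (hx : x ∈ U)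
    (i j : Fin 3) : DifferentiableAt ℝ (fun t : ℝ => ginv (g + t • h) x i j) 0 :=
  DifferentiableAt.comp (0 : ℝ) (f := fun t : ℝ => (t, x))
    ((contDiffAt_ginv_add_smul hg hh hx i j).differentiableAt (by simp)) (by fun_prop)

theorem differentiableAt_christoffel_add_smul (hg : IsMetricOn g U) (hh : IsSmoothSymm h)
    (hx : x ∈ U) (k i j : Fin 3) :
    DifferentiableAt ℝ (fun t : ℝ => christoffel (g + t • h) k i j x) 0 :=
  DifferentiableAt.comp (0 : ℝ) (f := fun t : ℝ => (t, x))
    ((contDiffAt_christoffel_add_smul hg hh hx k i j).differentiableAt (by simp)) (by fun_prop)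

theorem hasDerivAt_ginv_add_smul (hg : IsMetricOn g U) (hh : IsSmoothSymm h) (hx : x ∈ U)
    (i j : Fin 3) :
    HasDerivAt (fun t : ℝ => ginv (g + t • h) x i j)
      (-∑ a, ∑ b, ginv g x i a * h x a b * ginv g x b j) 0 := by
  have hdet : ∀ᶠ t : ℝ in 𝓝 0, ((g + t • h) x).det ≠ 0 := by
    have hc : Continuous fun t : ℝ => ((g + t • h) x).det := by
      simp only [Matrix.det_fin_three, add_smul_apply]; fun_prop
    exact hc.continuousAt.eventually_ne (by simpa using hg.det_ne x hx)
  have hB : DifferentiableAt ℝ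
      (fun t : ℝ => ∑ a, ∑ b, ginv (g + t • h) x i a * h x a b * ginv g x b j) 0 :=
    DifferentiableAt.fun_sum fun a _ => DifferentiableAt.fun_sum fun b _ =>
      ((differentiableAt_ginv_add_smul hg hh hx i a).mul_const _).mul_const _
  have key := (hasDerivAt_id_mul hB).const_sub (ginv g x i j)
  simp only [zero_smul, add_zero] at key
  refine key.congr_of_eventuallyEq ?_
  filter_upwards [hdet] with t ht
  have e1 : ((g + t • h) x)⁻¹ * ((g + t • h) x) = 1 := Matrix.nonsing_inv_mul _ ht.isUnit
  have e2 : g x * (g x)⁻¹ = 1 := Matrix.mul_nonsing_inv _ (hg.det_ne x hx).isUnit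
  -- The resolvent identity: it exhibits a factor `t`, so the derivative at 0 only needs the value
  -- of the cofactor there.
  have e3 : ((g + t • h) x)⁻¹ = (g x)⁻¹ - t • (((g + t • h) x)⁻¹ * h x * (g x)⁻¹) := by
    have : (g + t • h) x = g x + t • h x := rfl
    calc ((g + t • h) x)⁻¹ = ((g + t • h) x)⁻¹ * (g x * (g x)⁻¹) := by rw [e2, mul_one]
      _ = ((g + t • h) x)⁻¹ * ((g + t • h) x - t • h x) * (g x)⁻¹ := by
        rw [mul_assoc]; congr 2; rw [this]; simp
      _ = _ := by rw [mul_sub, e1, sub_mul, one_mul, mul_smul_comm, smul_mul_assoc]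
  have e4 := congrFun (congrFun e3 i) j
  simp only [ginv]
  rw [e4]
  simp only [Matrix.sub_apply, Matrix.smul_apply, Matrix.mul_apply, smul_eq_mul, Finset.sum_mul]
  rw [Finset.sum_comm]

theorem christoffel_symm (hg : IsMetricOn g U) (hx : x ∈ U) (k i j : Fin 3) :
    christoffel g k i j x = christoffel g k j i x := by
  unfold christoffel
  congr 1
  refine Finset.sum_congr rfl fun l _ => ?_
  rw [pd_congr hg.isOpen (fun y hy => hg.symm y hy i j) hx l]
  ring

/-- The first variation `½ g^{kl} (∇_i h_{jl} + ∇_j h_{il} - ∇_l h_{ij})` of `Γ^k_{ij}`. -/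
def varChristoffel (g h : Tensor2) (k i j : Fin 3) (x : E3) : ℝ :=
  (1 / 2) * ∑ l, ginv g x k l * (covDeriv g h x i j l + covDeriv g h x j i l - covDeriv g h x l i j)

/-- The variation of a connection is a tensor: differentiating `g⁻¹` produces `-g^{kl} h_lb Γ^b_ij`,
which is exactly what completes the partial derivatives of `h` to covariant ones. -/
theorem hasDerivAt_christoffel (hg : IsMetricOn g U) (hh : IsSmoothSymm h) (hx : x ∈ U)
    (k i j : Fin 3) :
    HasDerivAt (fun t : ℝ => christoffel (g + t • h) k i j x) (varChristoffel g h k i j x) 0 := by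
  have hp : ∀ a b c, HasDerivAt (fun t : ℝ => pd a (fun y => (g + t • h) y b c) x)
      (pd a (fun y => h y b c) x) 0 := by
    intro a b c
    simp only [pd_add_smul hg hh hx]
    simpa using ((hasDerivAt_id (0 : ℝ)).mul_const (pd a (fun y => h y b c) x)).const_add
      (pd a (fun y => g y b c) x)
  have key := (HasDerivAt.fun_sum (u := Finset.univ) fun l _ =>
    (hasDerivAt_ginv_add_smul hg hh hx k l).fun_mul
      (((hp i j l).fun_add (hp j i l)).fun_sub (hp l i j))).const_mul (1 / 2 : ℝ)
  unfold christoffel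
  refine key.congr_deriv ?_
  have hsum : ∑ l, (∑ a, ∑ b, ginv g x k a * h x a b * ginv g x b l) *
      (pd i (fun y => g y j l) x + pd j (fun y => g y i l) x - pd l (fun y => g y i j) x)
      = 2 * ∑ l, ginv g x k l * ∑ b, h x l b * christoffel g b i j x := by
    simp only [christoffel, Fin.sum_univ_three]
    ring
  have hcov : ∀ l, covDeriv g h x i j l + covDeriv g h x j i l - covDeriv g h x l i j =
      pd i (fun y => h y j l) x + pd j (fun y => h y i l) x - pd l (fun y => h y i j) x
      - 2 * ∑ b, h x l b * christoffel g b i j x := by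
    intro l
    simp only [covDeriv, Fin.sum_univ_three, christoffel_symm hg hx _ j i,
      christoffel_symm hg hx _ l i, christoffel_symm hg hx _ l j, hh.symm x _ l, hh.symm x _ j]
    ring
  simp only [zero_smul, add_zero]
  simp only [varChristoffel, hcov, mul_sub, Finset.sum_sub_distrib, neg_mul,
    Finset.sum_add_distrib, Finset.sum_neg_distrib, mul_add] at hsum ⊢
  have e2 : ∑ l, ginv g x k l * (2 * ∑ b, h x l b * christoffel g b i j x)
      = 2 * ∑ l, ginv g x k l * ∑ b, h x l b * christoffel g b i j x := by
    rw [Finset.mul_sum]; exact Finset.sum_congr rfl fun _ _ => by ring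
  rw [e2]
  linear_combination (-1 / 2 : ℝ) * hsum

/-- The first variation of the component `R_{ij}` of the Ricci tensor. -/
def varRicci (g h : Tensor2) (x : E3) (i j : Fin 3) : ℝ :=
  ∑ k, (pd k (varChristoffel g h k i j) x - pd j (varChristoffel g h k i k) x
    + ∑ l, ((varChristoffel g h k k l x * christoffel g l i j x
        + christoffel g k k l x * varChristoffel g h l i j x)
      - (varChristoffel g h k j l x * christoffel g l i k x
        + christoffel g k j l x * varChristoffel g h l i k x)))

theorem hasDerivAt_pd_christoffel (hg : IsMetricOn g U) (hh : IsSmoothSymm h) (hx : x ∈ U)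
    (n k i j : Fin 3) :
    HasDerivAt (fun t : ℝ => pd n (christoffel (g + t • h) k i j) x)
      (pd n (varChristoffel g h k i j) x) 0 := by
  have := hasDerivAt_pd_of_contDiffAt (contDiffAt_christoffel_add_smul hg hh hx k i j) n
  rwa [pd_congr hg.isOpen (v := varChristoffel g h k i j)
    (fun y hy => (hasDerivAt_christoffel hg hh hy k i j).deriv) hx] at this

theorem hasDerivAt_ricci (hg : IsMetricOn g U) (hh : IsSmoothSymm h) (hx : x ∈ U)
    (i j : Fin 3) :
    HasDerivAt (fun t : ℝ => ricci (g + t • h) x i j) (varRicci g h x i j) 0 := by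
  have hc := fun k i j => hasDerivAt_christoffel hg hh hx k i j
  have hp := fun n k i j => hasDerivAt_pd_christoffel hg hh hx n k i j
  have key := HasDerivAt.fun_sum (u := Finset.univ) fun k _ =>
    ((hp k k i j).fun_sub (hp j k i k)).fun_add (HasDerivAt.fun_sum (u := Finset.univ) fun l _ =>
      ((hc k k l).fun_mul (hc l i j)).fun_sub ((hc k j l).fun_mul (hc l i k)))
  simp only [zero_smul, add_zero] at key
  exact key

theorem hasDerivAt_scalarCurv (hg : IsMetricOn g U) (hh : IsSmoothSymm h) (hx : x ∈ U) :
    HasDerivAt (fun t : ℝ => scalarCurv (g + t • h) x)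
      (∑ i, ∑ j, ((-∑ a, ∑ b, ginv g x i a * h x a b * ginv g x b j) * ricci g x i j
        + ginv g x i j * varRicci g h x i j)) 0 := by
  have key := HasDerivAt.fun_sum (u := Finset.univ) fun i _ =>
    HasDerivAt.fun_sum (u := Finset.univ) fun j _ =>
      (hasDerivAt_ginv_add_smul hg hh hx i j).fun_mul (hasDerivAt_ricci hg hh hx i j)
  simp only [zero_smul, add_zero] at key
  exact key

/-- Only the scalar curvature contributes: with zero background momentum the terms quadratic in `t •
w` are of order `t²`. -/
theorem DPhi_fst (hg : IsMetricOn g U) (hh : IsSmoothSymm h) (hx : x ∈ U) :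
    (DPhi g 0 h w x).1 =
      ∑ i, ∑ j, ((-∑ a, ∑ b, ginv g x i a * h x a b * ginv g x b j) * ricci g x i j
        + ginv g x i j * varRicci g h x i j) := by
  have hG := differentiableAt_ginv_add_smul hg hh hx
  have ht : DifferentiableAt ℝ
      (fun t : ℝ => t * (∑ i, ∑ j, ginv (g + t • h) x i j * w x i j) ^ 2) 0 := by
    fun_prop
  have hi : DifferentiableAt ℝ (fun t : ℝ => t * ∑ i, ∑ j, ∑ k, ∑ l,
      ginv (g + t • h) x i k * ginv (g + t • h) x j l * w x i j * w x k l) 0 := by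
    fun_prop
  have key := ((hasDerivAt_scalarCurv hg hh hx).fun_add
    ((hasDerivAt_id_mul ht).const_mul (1 / 2 : ℝ))).fun_sub (hasDerivAt_id_mul hi)
  simp only [zero_mul, mul_zero, add_zero, sub_zero] at key
  refine Eq.trans ?_ key.deriv
  simp only [DPhi, Phi, hamiltonian, traceAt, inner2, zero_add]
  congr 1
  funext t
  have e1 : ∑ i, ∑ j, ginv (g + t • h) x i j * (t • w) x i j =
      t * ∑ i, ∑ j, ginv (g + t • h) x i j * w x i j := by
    simp only [Finset.mul_sum]
    refine Finset.sum_congr rfl fun i _ => Finset.sum_congr rfl fun j _ => ?_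
    show _ * (t * w x i j) = _
    ring
  have e2 : ∑ i, ∑ j, ∑ k, ∑ l,
        ginv (g + t • h) x i k * ginv (g + t • h) x j l * (t • w) x i j * (t • w) x k l =
      t * (t * ∑ i, ∑ j, ∑ k, ∑ l,
        ginv (g + t • h) x i k * ginv (g + t • h) x j l * w x i j * w x k l) := by
    simp only [Finset.mul_sum]
    refine Finset.sum_congr rfl fun i _ => Finset.sum_congr rfl fun j _ =>
      Finset.sum_congr rfl fun k _ => Finset.sum_congr rfl fun l _ => ?_
    show _ * (t * w x i j) * (t * w x k l) = _
    ring
  rw [e1, e2]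
  ring

/-- The divergence is linear in the momentum `t • w`, so the variation of the metric enters only at
order `t²`. -/
theorem DPhi_snd (hg : IsMetricOn g U) (hh : IsSmoothSymm h) (hw : IsSmoothSymm w) (hx : x ∈ U)
    (i : Fin 3) : (DPhi g 0 h w x).2 i = divergence g w x i := by
  have hG := differentiableAt_ginv_add_smul hg hh hx
  have hC := differentiableAt_christoffel_add_smul hg hh hx
  have hd : DifferentiableAt ℝ (fun t : ℝ => divergence (g + t • h) w x i) 0 := by
    unfold divergence covDeriv
    fun_prop
  have key := hasDerivAt_id_mul hd
  simp only [zero_smul, add_zero] at key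
  refine Eq.trans ?_ key.deriv
  simp only [DPhi, Phi, zero_add]
  congr 1
  funext t
  simp only [divergence, Finset.mul_sum]
  refine Finset.sum_congr rfl fun l _ => Finset.sum_congr rfl fun j _ =>
    Finset.sum_congr rfl fun k _ => ?_
  have e : covDeriv (g + t • h) (t • w) x j k l = t * covDeriv (g + t • h) w x j k l := by
    simp only [covDeriv]
    have : pd j (fun y => (t • w) y k l) x = t * pd j (fun y => w y k l) x :=
      ((HasGrad.self ((hw.smooth k l).differentiable (by simp) x)).const_mul t).pd_eq j
    rw [this, mul_sub, Finset.mul_sum]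
    congr 1
    refine Finset.sum_congr rfl fun s _ => ?_
    show _ * (t * w x s l) + _ * (t * w x k s) = _
    ring
  rw [e]
  ring

end

/-! ### Index identities -/

section Algebra

variable {G : Fin 3 → Fin 3 → ℝ} {Γ C N : Fin 3 → Fin 3 → Fin 3 → ℝ}

/-- The contracted Palatini identity: `g^{ij} δR_ij` is the covariant divergence of `V^k = g^{ij}
δΓ^k_ij - g^{ik} δΓ^l_il`. Here `C` stands for `δΓ` and `dC` for its derivatives, while the
derivatives of `G` have been eliminated by metric compatibility. -/
theorem contracted_varRicci_eq (dC : Fin 3 → Fin 3 → Fin 3 → Fin 3 → ℝ)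
    (hG : ∀ i j, G i j = G j i) (hΓ : ∀ k i j, Γ k i j = Γ k j i)
    (hC : ∀ k i j, C k i j = C k j i) :
    ∑ i, ∑ j, G i j * ∑ k, (dC k k i j - dC j k i k + ∑ l, ((C k k l * Γ l i j + Γ k k l * C l i j)
        - (C k j l * Γ l i k + Γ k j l * C l i k))) =
      ∑ k, ((∑ l, Γ l k l) * (∑ i, ∑ j, G i j * C k i j - ∑ i, ∑ l, G i k * C l i l)
        + (∑ i, ∑ j, ((-∑ l, (Γ i k l * G l j + Γ j k l * G i l)) * C k i j + G i j * dC k k i j)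
        - ∑ i, ∑ l, ((-∑ l, (Γ i k l * G l k + Γ k k l * G i l)) * C l i l
          + G i k * dC k l i l))) := by
  have a0 := hG 1 0; have a1 := hG 2 0; have a2 := hG 2 1
  have b0 := fun k => hΓ k 1 0; have b1 := fun k => hΓ k 2 0; have b2 := fun k => hΓ k 2 1
  have c0 := fun k => hC k 1 0; have c1 := fun k => hC k 2 0; have c2 := fun k => hC k 2 1
  simp only [Fin.sum_univ_three, a0, a1, a2, b0, b1, b2, c0, c1, c2]
  ring

/-- With `N_ijl = ∇_i h_jl` and `u = df`, this moves the pairing of `df` with the Palatini vector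
onto `∇h`, ready for a second integration by parts. -/
theorem contracted_varChristoffel_eq (u : Fin 3 → ℝ)
    (hG : ∀ i j, G i j = G j i) (hN : ∀ k i j, N k i j = N k j i)
    (hC : ∀ k i j, C k i j = 1 / 2 * ∑ l, G k l * (N i j l + N j i l - N l i j)) :
    ∑ k, u k * (∑ i, ∑ j, G i j * C k i j - ∑ i, ∑ l, G i k * C l i l) =
      ∑ i, ∑ j, ∑ l, (∑ k, u k * (G i j * G k l - G i k * G j l)) * N i j l := by
  have a0 := hG 1 0; have a1 := hG 2 0; have a2 := hG 2 1
  have b0 := fun k => hN k 1 0; have b1 := fun k => hN k 2 0; have b2 := fun k => hN k 2 1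
  simp only [hC, Fin.sum_univ_three, a0, a1, a2, b0, b1, b2]
  ring

/-- The Leibniz rule `T·∇h + (div T)·h = div(T·h)`: the connection terms on the contracted indices
`j`, `l` cancel, and only the trace `Γ^l_il` survives. -/
theorem div_pairing_eq (T : Fin 3 → Fin 3 → Fin 3 → ℝ) (dT : Fin 3 → Fin 3 → Fin 3 → Fin 3 → ℝ)
    (h : Fin 3 → Fin 3 → ℝ) (dh : Fin 3 → Fin 3 → Fin 3 → ℝ)
    (hΓ : ∀ k i j, Γ k i j = Γ k j i) :
    ∑ i, ∑ j, ∑ l, T i j l * (dh i j l - ∑ s, (Γ s i j * h s l + Γ s i l * h j s))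
      + ∑ j, ∑ l, (∑ i, (dT i i j l
        + ∑ n, (Γ i i n * T n j l + Γ j i n * T i n l + Γ l i n * T i j n))) * h j l =
    ∑ i, ((∑ l, Γ l i l) * ∑ j, ∑ l, T i j l * h j l
      + ∑ j, ∑ l, (dT i i j l * h j l + T i j l * dh i j l)) := by
  have b0 := fun k => hΓ k 1 0; have b1 := fun k => hΓ k 2 0; have b2 := fun k => hΓ k 2 1
  simp only [Fin.sum_univ_three, b0, b1, b2]
  ring

/-- Because `∇g⁻¹ = 0`, the divergence falls on `u = df` alone and produces `∇^j∇^l f - (Δf)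
g^{jl}`. -/
theorem tensorDiv_gradient_eq {dG : Fin 3 → Fin 3 → Fin 3 → ℝ} (u : Fin 3 → ℝ)
    (du : Fin 3 → Fin 3 → ℝ) (hG : ∀ i j, G i j = G j i) (hΓ : ∀ k i j, Γ k i j = Γ k j i)
    (hdG : ∀ k i j, dG k i j = -∑ l, (Γ i k l * G l j + Γ j k l * G i l)) (j l : Fin 3) :
    ∑ i, (∑ k, (du i k * (G i j * G k l - G i k * G j l)
        + u k * ((dG i i j * G k l + G i j * dG i k l) - (dG i i k * G j l + G i k * dG i j l)))
      + ∑ n, (Γ i i n * (∑ k, u k * (G n j * G k l - G n k * G j l))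
        + Γ j i n * (∑ k, u k * (G i n * G k l - G i k * G n l))
        + Γ l i n * ∑ k, u k * (G i j * G k n - G i k * G j n))) =
      ∑ a, ∑ b, G j a * G l b * (du a b - ∑ k, Γ k a b * u k)
        - G j l * ∑ a, ∑ b, G a b * (du a b - ∑ k, Γ k a b * u k) := by
  have a0 := hG 1 0; have a1 := hG 2 0; have a2 := hG 2 1
  have b0 := fun k => hΓ k 1 0; have b1 := fun k => hΓ k 2 0; have b2 := fun k => hΓ k 2 1
  have j0 := hG 0 j; have j1 := hG 1 j; have j2 := hG 2 j
  have l0 := hG 0 l; have l1 := hG 1 l; have l2 := hG 2 l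
  simp only [hdG, Fin.sum_univ_three, a0, a1, a2, b0, b1, b2, j0, j1, j2, l0, l1, l2]
  ring

theorem tensorDiv_vector_eq {dG : Fin 3 → Fin 3 → Fin 3 → ℝ} (X : Fin 3 → ℝ)
    (dX : Fin 3 → Fin 3 → ℝ) (hG : ∀ i j, G i j = G j i) (hΓ : ∀ k i j, Γ k i j = Γ k j i)
    (hdG : ∀ k i j, dG k i j = -∑ l, (Γ i k l * G l j + Γ j k l * G i l)) (j l : Fin 3) :
    ∑ i, ((dG i i j * X l + G i j * dX i l)
      + ∑ n, (Γ i i n * (G n j * X l) + Γ j i n * (G i n * X l) + Γ l i n * (G i j * X n))) =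
      ∑ i, G i j * (dX i l + ∑ n, Γ l i n * X n) := by
  have a0 := hG 1 0; have a1 := hG 2 0; have a2 := hG 2 1
  have b0 := fun k => hΓ k 1 0; have b1 := fun k => hΓ k 2 0; have b2 := fun k => hΓ k 2 1
  have j0 := hG 0 j; have j1 := hG 1 j; have j2 := hG 2 j
  simp only [hdG, Fin.sum_univ_three, a0, a1, a2, b0, b1, b2, j0, j1, j2]
  ring

end Algebra

/-! ### The formal adjoint as a differential operator -/

/-- The divergence `∇_i T^{ijl}`. -/
def tensorDiv (g : Tensor2) (T : Fin 3 → Fin 3 → Fin 3 → E3 → ℝ) (x : E3) (j l : Fin 3) : ℝ :=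
  ∑ i, (pd i (T i j l) x + ∑ n, (christoffel g i i n x * T n j l x
    + christoffel g j i n x * T i n l x + christoffel g l i n x * T i j n x))

/-- The Hessian `∇_a ∇_b f`. -/
def hess (g : Tensor2) (f : E3 → ℝ) (x : E3) (a b : Fin 3) : ℝ :=
  pd a (pd b f) x - ∑ k, christoffel g k a b x * pd k f x

/-- The covariant derivative `∇^j X^l` with the first index raised. -/
def covUp (g : Tensor2) (X : E3 → Fin 3 → ℝ) (x : E3) (j l : Fin 3) : ℝ :=
  ∑ i, ginv g x i j * (pd i (fun y => X y l) x + ∑ n, christoffel g l i n x * X x n)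

/-- The tensor `∇^j ∇^l f - (Δ f) g^{jl} - f R^{jl}`. -/
def staticUp (g : Tensor2) (f : E3 → ℝ) (x : E3) (j l : Fin 3) : ℝ :=
  ∑ a, ∑ b, ginv g x j a * ginv g x l b * (hess g f x a b - f x * ricci g x a b)
    - ginv g x j l * ∑ a, ∑ b, ginv g x a b * hess g f x a b

/-- The vector `g^{ij} δΓ^k_{ij} - g^{ik} δΓ^l_{il}`. -/
def varVec (g h : Tensor2) (k : Fin 3) (x : E3) : ℝ :=
  ∑ i, ∑ j, ginv g x i j * varChristoffel g h k i j x
    - ∑ i, ∑ l, ginv g x i k * varChristoffel g h l i l x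

/-- The tensor `g^{ij} ∇^l f - ∇^i f g^{jl}`. -/
def gradTensor (g : Tensor2) (f : E3 → ℝ) (i j l : Fin 3) (x : E3) : ℝ :=
  ∑ k, pd k f x * (ginv g x i j * ginv g x k l - ginv g x i k * ginv g x j l)

/-- The tensor `g^{ij} X^l`. -/
def vecTensor (g : Tensor2) (X : E3 → Fin 3 → ℝ) (i j l : Fin 3) (x : E3) : ℝ :=
  ginv g x i j * X x l

/-! ### Vanishing off the support of the test tensors -/

section Support

variable {g h : Tensor2} {x : E3}

theorem eq_zero_off_tsupport (hx : x ∉ tsupport h) (i j : Fin 3) : h x i j = 0 := by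
  rw [image_eq_zero_of_notMem_tsupport hx]; rfl

theorem covDeriv_off_tsupport (hx : x ∉ tsupport h) (i j k : Fin 3) :
    covDeriv g h x i j k = 0 := by
  simp only [covDeriv, eq_zero_off_tsupport hx,
    pd_eq_zero_of_compl (isClosed_tsupport h) (fun y hy => eq_zero_off_tsupport hy j k) hx i]
  simp

theorem varChristoffel_off_tsupport (hx : x ∉ tsupport h) (k i j : Fin 3) :
    varChristoffel g h k i j x = 0 := by
  simp [varChristoffel, covDeriv_off_tsupport hx]

theorem varVec_off_tsupport (hx : x ∉ tsupport h) (k : Fin 3) : varVec g h k x = 0 := by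
  simp [varVec, varChristoffel_off_tsupport hx]

theorem varRicci_off_tsupport (hx : x ∉ tsupport h) (i j : Fin 3) : varRicci g h x i j = 0 := by
  have hp : ∀ n k i j, pd n (varChristoffel g h k i j) x = 0 := fun n k i j =>
    pd_eq_zero_of_compl (isClosed_tsupport h) (fun y hy => varChristoffel_off_tsupport hy k i j) hx n
  simp [varRicci, varChristoffel_off_tsupport hx, hp]

theorem divergence_off_tsupport (hx : x ∉ tsupport h) (i : Fin 3) : divergence g h x i = 0 := by
  simp [divergence, covDeriv_off_tsupport hx]

end Support

/-! ### Smoothness and pointwise divergence identities -/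

section Pointwise

variable {m : ℝ} {h w : Tensor2} {U : Set E3} {x : E3} {f : E3 → ℝ} {X : E3 → Fin 3 → ℝ}

theorem covDeriv_smooth (hU : IsOpen U) (hUe : U ⊆ exterior m) (hh : IsSmoothSymm h)
    (i j k : Fin 3) : ContDiffOn ℝ ∞ (fun y => covDeriv (schwarzschild m) h y i j k) U := by
  have hc := fun k i j => (christoffel_schwarzschild_smooth (m := m) k i j).mono hUe
  have hs := fun i j => (hh.smooth i j).contDiffOn (s := U)
  exact (smooth_pd hU (hs j k) i).sub (ContDiffOn.sum fun s _ =>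
    ((hc s i j).mul (hs s k)).add ((hc s i k).mul (hs j s)))

theorem varChristoffel_smooth (hU : IsOpen U) (hUe : U ⊆ exterior m) (hh : IsSmoothSymm h)
    (k i j : Fin 3) : ContDiffOn ℝ ∞ (varChristoffel (schwarzschild m) h k i j) U := by
  have hd := fun i j k => covDeriv_smooth hU hUe hh i j k
  exact contDiffOn_const.mul (ContDiffOn.sum fun l _ =>
    ((ginv_schwarzschild_smooth k l).mono hUe).mul (((hd i j l).add (hd j i l)).sub (hd l i j)))

theorem varVec_smooth (hU : IsOpen U) (hUe : U ⊆ exterior m) (hh : IsSmoothSymm h)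
    (k : Fin 3) : ContDiffOn ℝ ∞ (varVec (schwarzschild m) h k) U := by
  have hv := fun k i j => varChristoffel_smooth hU hUe hh k i j
  have hG := fun i j => (ginv_schwarzschild_smooth (m := m) i j).mono hUe
  exact (ContDiffOn.sum fun i _ => ContDiffOn.sum fun j _ => (hG i j).mul (hv k i j)).sub
    (ContDiffOn.sum fun i _ => ContDiffOn.sum fun l _ => (hG i k).mul (hv l i l))

theorem gradTensor_smooth (hU : IsOpen U) (hUe : U ⊆ exterior m) (hf : ContDiffOn ℝ ∞ f U)
    (i j l : Fin 3) : ContDiffOn ℝ ∞ (gradTensor (schwarzschild m) f i j l) U := by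
  have hG := fun i j => (ginv_schwarzschild_smooth (m := m) i j).mono hUe
  exact ContDiffOn.sum fun k _ => (smooth_pd hU hf k).mul
    (((hG i j).mul (hG k l)).sub ((hG i k).mul (hG j l)))

theorem vecTensor_smooth (hUe : U ⊆ exterior m)
    (hX : ∀ i, ContDiffOn ℝ ∞ (fun y => X y i) U)
    (i j l : Fin 3) : ContDiffOn ℝ ∞ (vecTensor (schwarzschild m) X i j l) U :=
  ((ginv_schwarzschild_smooth (m := m) i j).mono hUe).mul (hX l)

theorem covDeriv_symm (hh : IsSmoothSymm h) (g : Tensor2) (x : E3) (i j k : Fin 3) :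
    covDeriv g h x i j k = covDeriv g h x i k j := by
  simp only [covDeriv, hh.symm _ j k]
  congr 1
  refine Finset.sum_congr rfl fun s _ => ?_
  rw [hh.symm x s k, hh.symm x j s]
  ring

theorem varChristoffel_symm (hh : IsSmoothSymm h) (g : Tensor2) (x : E3) (k i j : Fin 3) :
    varChristoffel g h k i j x = varChristoffel g h k j i x := by
  simp only [varChristoffel]
  congr 1
  refine Finset.sum_congr rfl fun l _ => ?_
  rw [covDeriv_symm hh g x l i j]
  ring

theorem sum_ginv_mul_varRicci (hx : x ∈ exterior m) (hh : IsSmoothSymm h) :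
    volDensity (schwarzschild m) x *
        ∑ i, ∑ j, ginv (schwarzschild m) x i j * varRicci (schwarzschild m) h x i j =
      ∑ k, pd k (fun y => volDensity (schwarzschild m) y * varVec (schwarzschild m) h k y) x := by
  have hO := isOpen_exterior m
  have hG := fun i j => hasGrad_of_smooth hO (ginv_schwarzschild_smooth (m := m) i j) hx
  have hC := fun k i j => hasGrad_of_smooth hO
    (varChristoffel_smooth hO subset_rfl hh k i j) hx
  have hV := hasGrad_of_smooth hO (volDensity_schwarzschild_smooth (m := m)) hx
  have hP : ∀ k, HasGrad
      (fun y => volDensity (schwarzschild m) y * varVec (schwarzschild m) h k y) _ x := fun k =>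
    hV.mul ((HasGrad.sum Finset.univ fun i _ => HasGrad.sum Finset.univ fun j _ =>
      (hG i j).mul (hC k i j)).sub (HasGrad.sum Finset.univ fun i _ =>
        HasGrad.sum Finset.univ fun l _ => (hG i k).mul (hC l i l)))
  rw [Finset.sum_congr rfl fun k _ => (hP k).pd_eq k]
  simp only [varRicci, pd_volDensity_schwarzschild hx, pd_ginv_schwarzschild hx]
  rw [contracted_varRicci_eq (fun n k i j => pd n (varChristoffel (schwarzschild m) h k i j) x)
    (ginv_schwarzschild_symm hx) (christoffel_schwarzschild_symm hx)
    (varChristoffel_symm hh (schwarzschild m) x), Finset.mul_sum]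
  refine Finset.sum_congr rfl fun k _ => ?_
  simp only [varVec]
  ring

theorem sum_pd_mul_varVec (hx : x ∈ exterior m) (hh : IsSmoothSymm h) (f : E3 → ℝ) :
    ∑ k, pd k f x * varVec (schwarzschild m) h k x =
      ∑ i, ∑ j, ∑ l, gradTensor (schwarzschild m) f i j l x
        * covDeriv (schwarzschild m) h x i j l :=
  contracted_varChristoffel_eq (fun k => pd k f x) (ginv_schwarzschild_symm hx)
    (covDeriv_symm hh (schwarzschild m) x) fun _ _ _ => rfl

theorem tensor_pairing_eq_div (hU : IsOpen U) (hUe : U ⊆ exterior m) (hx : x ∈ U)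
    (hh : IsSmoothSymm h)
    {T : Fin 3 → Fin 3 → Fin 3 → E3 → ℝ} (hT : ∀ i j l, ContDiffOn ℝ ∞ (T i j l) U) :
    volDensity (schwarzschild m) x *
        (∑ i, ∑ j, ∑ l, T i j l x * covDeriv (schwarzschild m) h x i j l
          + ∑ j, ∑ l, tensorDiv (schwarzschild m) T x j l * h x j l) =
      ∑ i, pd i (fun y => volDensity (schwarzschild m) y * ∑ j, ∑ l, T i j l y * h y j l) x := by
  have hV := hasGrad_of_smooth hU ((volDensity_schwarzschild_smooth (m := m)).mono hUe) hx
  have hP : ∀ i, HasGrad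
      (fun y => volDensity (schwarzschild m) y * ∑ j, ∑ l, T i j l y * h y j l) _ x := fun i =>
    hV.mul (HasGrad.sum Finset.univ fun j _ => HasGrad.sum Finset.univ fun l _ =>
      (hasGrad_of_smooth hU (hT i j l) hx).mul
        (hasGrad_of_smooth hU (hh.smooth j l).contDiffOn hx))
  rw [Finset.sum_congr rfl fun i _ => (hP i).pd_eq i]
  simp only [covDeriv, tensorDiv, pd_volDensity_schwarzschild (hUe hx)]
  rw [div_pairing_eq (fun i j l => T i j l x) (fun n i j l => pd n (T i j l) x) (h x)
    (fun n j l => pd n (fun y => h y j l) x) (christoffel_schwarzschild_symm (hUe hx)),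
    Finset.mul_sum]
  refine Finset.sum_congr rfl fun k _ => ?_
  ring

theorem tensorDiv_gradTensor (hU : IsOpen U) (hUe : U ⊆ exterior m) (hx : x ∈ U)
    (hf : ContDiffOn ℝ ∞ f U) (j l : Fin 3) :
    tensorDiv (schwarzschild m) (gradTensor (schwarzschild m) f) x j l =
      ∑ a, ∑ b, ginv (schwarzschild m) x j a * ginv (schwarzschild m) x l b
          * hess (schwarzschild m) f x a b
        - ginv (schwarzschild m) x j l *
          ∑ a, ∑ b, ginv (schwarzschild m) x a b * hess (schwarzschild m) f x a b := by
  have hG := fun i j => hasGrad_of_smooth (isOpen_exterior m)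
    (ginv_schwarzschild_smooth (m := m) i j) (hUe hx)
  have hu := fun k => hasGrad_of_smooth hU (smooth_pd hU hf k) hx
  have hT : ∀ i, HasGrad (gradTensor (schwarzschild m) f i j l) _ x := fun i =>
    HasGrad.sum Finset.univ fun k _ => (hu k).mul
      (((hG i j).mul (hG k l)).sub ((hG i k).mul (hG j l)))
  simp only [tensorDiv, (hT _).pd_eq]
  exact tensorDiv_gradient_eq (fun k => pd k f x) (fun a b => pd a (pd b f) x)
    (ginv_schwarzschild_symm (hUe hx)) (christoffel_schwarzschild_symm (hUe hx))
    (pd_ginv_schwarzschild (hUe hx)) j l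

theorem tensorDiv_vecTensor (hU : IsOpen U) (hUe : U ⊆ exterior m) (hx : x ∈ U)
    (hX : ∀ i, ContDiffOn ℝ ∞ (fun y => X y i) U) (j l : Fin 3) :
    tensorDiv (schwarzschild m) (vecTensor (schwarzschild m) X) x j l =
      covUp (schwarzschild m) X x j l := by
  have hG := fun i j => hasGrad_of_smooth (isOpen_exterior m)
    (ginv_schwarzschild_smooth (m := m) i j) (hUe hx)
  have hT : ∀ i, HasGrad (vecTensor (schwarzschild m) X i j l) _ x := fun i =>
    (hG i j).mul (hasGrad_of_smooth hU (hX l) hx)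
  simp only [tensorDiv, (hT _).pd_eq]
  exact tensorDiv_vector_eq (X x) (fun a b => pd a (fun y => X y b) x)
    (ginv_schwarzschild_symm (hUe hx)) (christoffel_schwarzschild_symm (hUe hx))
    (pd_ginv_schwarzschild (hUe hx)) j l

theorem sum_schwarzschild_mul_ginv (hx : x ∈ exterior m) (i j : Fin 3) :
    ∑ k, schwarzschild m x i k * ginv (schwarzschild m) x k j = kd i j := by
  simp only [schwarzschild_apply hx, ginv_schwarzschild hx]
  rw [sum_rank_one_mul, sum_coord_mul_self, schwPsi_sub_schwPhi hx, zero_mul, add_zero]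

theorem inner1_divergence (hx : x ∈ exterior m) (w : Tensor2) :
    inner1 (schwarzschild m) x (X x) (divergence (schwarzschild m) w x) =
      ∑ i, ∑ j, ∑ l, vecTensor (schwarzschild m) X i j l x
        * covDeriv (schwarzschild m) w x i j l := by
  have h1 : inner1 (schwarzschild m) x (X x) (divergence (schwarzschild m) w x) =
      ∑ i, ∑ l, (∑ k, schwarzschild m x i k * ginv (schwarzschild m) x k l) * (X x i *
        ∑ a, ∑ b, ginv (schwarzschild m) x a b * covDeriv (schwarzschild m) w x a b l) := by
    simp only [inner1, divergence, Fin.sum_univ_three]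
    ring
  rw [h1]
  simp only [sum_schwarzschild_mul_ginv hx, sum_kd_mul]
  simp only [vecTensor, Fin.sum_univ_three]
  ring

end Pointwise

/-! ### Integration by parts -/

section Weak

variable {m : ℝ} {h w : Tensor2} {H U : Set E3} {x : E3} {f : E3 → ℝ} {X : E3 → Fin 3 → ℝ}

theorem ricci_smooth (hU : IsOpen U) (hUe : U ⊆ exterior m) (i j : Fin 3) :
    ContDiffOn ℝ ∞ (fun y => ricci (schwarzschild m) y i j) U := by
  have hc := fun k i j => (christoffel_schwarzschild_smooth (m := m) k i j).mono hUe
  have hp := fun n k i j => smooth_pd hU (hc k i j) n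
  exact ContDiffOn.sum fun k _ => ((hp k k i j).sub (hp j k i k)).add (ContDiffOn.sum fun l _ =>
    ((hc k k l).mul (hc l i j)).sub ((hc k j l).mul (hc l i k)))

theorem hess_smooth (hU : IsOpen U) (hUe : U ⊆ exterior m) (hf : ContDiffOn ℝ ∞ f U)
    (a b : Fin 3) : ContDiffOn ℝ ∞ (fun y => hess (schwarzschild m) f y a b) U := by
  have hc := fun k i j => (christoffel_schwarzschild_smooth (m := m) k i j).mono hUe
  have hp := fun n => smooth_pd hU hf n
  exact (smooth_pd hU (hp b) a).sub (ContDiffOn.sum fun k _ => (hc k a b).mul (hp k))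

theorem staticUp_smooth (hU : IsOpen U) (hUe : U ⊆ exterior m) (hf : ContDiffOn ℝ ∞ f U)
    (j l : Fin 3) : ContDiffOn ℝ ∞ (fun y => staticUp (schwarzschild m) f y j l) U := by
  have hG := fun i j => (ginv_schwarzschild_smooth (m := m) i j).mono hUe
  have hH := fun a b => hess_smooth hU hUe hf a b
  exact (ContDiffOn.sum fun a _ => ContDiffOn.sum fun b _ => ((hG j a).mul (hG l b)).mul
      ((hH a b).sub (hf.mul (ricci_smooth hU hUe a b)))).sub
    ((hG j l).mul (ContDiffOn.sum fun a _ => ContDiffOn.sum fun b _ => (hG a b).mul (hH a b)))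

theorem covUp_smooth (hU : IsOpen U) (hUe : U ⊆ exterior m)
    (hX : ∀ i, ContDiffOn ℝ ∞ (fun y => X y i) U) (j l : Fin 3) :
    ContDiffOn ℝ ∞ (fun y => covUp (schwarzschild m) X y j l) U := by
  have hG := fun i j => (ginv_schwarzschild_smooth (m := m) i j).mono hUe
  have hc := fun k i j => (christoffel_schwarzschild_smooth (m := m) k i j).mono hUe
  exact ContDiffOn.sum fun i _ => (hG i j).mul ((smooth_pd hU (hX l) i).add
    (ContDiffOn.sum fun n _ => (hc l i n).mul (hX n)))

/-- The flux whose divergence is the difference of the two sides of the adjoint identity. -/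
def flux (g h w : Tensor2) (f : E3 → ℝ) (X : E3 → Fin 3 → ℝ) (k : Fin 3) (y : E3) : ℝ :=
  f y * (volDensity g y * varVec g h k y)
    - volDensity g y * ∑ j, ∑ l, gradTensor g f k j l y * h y j l
    + volDensity g y * ∑ j, ∑ l, vecTensor g X k j l y * w y j l

/-- The integrand after integration by parts. -/
def adjointIntegrand (g h w : Tensor2) (f : E3 → ℝ) (X : E3 → Fin 3 → ℝ) (y : E3) : ℝ :=
  volDensity g y * (∑ j, ∑ l, staticUp g f y j l * h y j l - ∑ j, ∑ l, covUp g X y j l * w y j l)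

theorem vol_pairing_smooth (hUe : U ⊆ exterior m) (hh : IsSmoothSymm h)
    {T : Fin 3 → Fin 3 → E3 → ℝ} (hT : ∀ j l, ContDiffOn ℝ ∞ (T j l) U) :
    ContDiffOn ℝ ∞ (fun y => volDensity (schwarzschild m) y * ∑ j, ∑ l, T j l y * h y j l) U :=
  (volDensity_schwarzschild_smooth.mono hUe).mul (ContDiffOn.sum fun j _ =>
    ContDiffOn.sum fun l _ => (hT j l).mul (hh.smooth j l).contDiffOn)

theorem flux_smooth (hU : IsOpen U) (hUe : U ⊆ exterior m) (hh : IsSmoothSymm h)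
    (hw : IsSmoothSymm w) (hf : ContDiffOn ℝ ∞ f U) (hX : ∀ i, ContDiffOn ℝ ∞ (fun y => X y i) U)
    (k : Fin 3) : ContDiffOn ℝ ∞ (flux (schwarzschild m) h w f X k) U :=
  ((hf.mul ((volDensity_schwarzschild_smooth.mono hUe).mul (varVec_smooth hU hUe hh k))).sub
    (vol_pairing_smooth hUe hh fun j l => gradTensor_smooth hU hUe hf k j l)).add
    (vol_pairing_smooth hUe hw fun j l => vecTensor_smooth hUe hX k j l)

theorem adjointIntegrand_smooth (hU : IsOpen U) (hUe : U ⊆ exterior m) (hh : IsSmoothSymm h)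
    (hw : IsSmoothSymm w) (hf : ContDiffOn ℝ ∞ f U)
    (hX : ∀ i, ContDiffOn ℝ ∞ (fun y => X y i) U) :
    ContDiffOn ℝ ∞ (adjointIntegrand (schwarzschild m) h w f X) U :=
  ((vol_pairing_smooth hUe hh fun j l => staticUp_smooth hU hUe hf j l).sub
    (vol_pairing_smooth hUe hw fun j l => covUp_smooth hU hUe hX j l)).congr
    fun _ _ => mul_sub _ _ _

/-- Pointwise Green formula. For `h`, one integration by parts uses Palatini and a second moves `∇h`
onto `∇f`; for `w`, a single one moves the divergence onto `X`. What remains multiplies `h` and `w`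
algebraically. -/
theorem DPhi_pairing_eq_div (hU : IsOpen U) (hUe : U ⊆ exterior m) (hx : x ∈ U)
    (hh : IsSmoothSymm h) (hw : IsSmoothSymm w) (hf : ContDiffOn ℝ ∞ f U)
    (hX : ∀ i, ContDiffOn ℝ ∞ (fun y => X y i) U) :
    (f x * (DPhi (schwarzschild m) 0 h w x).1
        + inner1 (schwarzschild m) x (X x) (DPhi (schwarzschild m) 0 h w x).2)
        * volDensity (schwarzschild m) x =
      ∑ k, pd k (flux (schwarzschild m) h w f X k) x
        + adjointIntegrand (schwarzschild m) h w f X x := by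
  have hxe := hUe hx
  have hg := isMetricOn_schwarzschild m
  have hP : ∀ k, pd k (flux (schwarzschild m) h w f X k) x = _ := fun k =>
    (((hasGrad_of_smooth hU hf hx).mul (hasGrad_of_smooth hU
      ((volDensity_schwarzschild_smooth.mono hUe).mul (varVec_smooth hU hUe hh k)) hx)).sub
      (hasGrad_of_smooth hU (vol_pairing_smooth hUe hh fun j l =>
        gradTensor_smooth hU hUe hf k j l) hx) |>.add
      (hasGrad_of_smooth hU (vol_pairing_smooth hUe hw fun j l =>
        vecTensor_smooth hUe hX k j l) hx)).pd_eq k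
  have hsnd : (DPhi (schwarzschild m) 0 h w x).2 = divergence (schwarzschild m) w x :=
    funext fun i => DPhi_snd hg hh hw hxe i
  have e1 := sum_ginv_mul_varRicci hxe hh
  have e2 := sum_pd_mul_varVec hxe hh f
  have e3 := tensor_pairing_eq_div hU hUe hx hh (gradTensor_smooth hU hUe hf)
  have e4 := tensor_pairing_eq_div hU hUe hx hw (vecTensor_smooth hUe hX)
  have e5 := inner1_divergence (X := X) hxe w
  simp only [tensorDiv_vecTensor hU hUe hx hX] at e4
  -- The divergence of the gradient tensor is `staticUp` without its Ricci term. The extra `f Ric·h`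
  -- cancels the variation of `g⁻¹` in the scalar curvature, isolated in `e7`.
  have e6 : ∑ j, ∑ l, tensorDiv (schwarzschild m) (gradTensor (schwarzschild m) f) x j l * h x j l
      = ∑ j, ∑ l, staticUp (schwarzschild m) f x j l * h x j l
        + f x * ∑ j, ∑ l, (∑ a, ∑ b, ginv (schwarzschild m) x j a * ginv (schwarzschild m) x l b
          * ricci (schwarzschild m) x a b) * h x j l := by
    rw [Finset.mul_sum, ← Finset.sum_add_distrib]
    refine Finset.sum_congr rfl fun j _ => ?_
    rw [Finset.mul_sum, ← Finset.sum_add_distrib]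
    refine Finset.sum_congr rfl fun l _ => ?_
    have : ∑ a, ∑ b, ginv (schwarzschild m) x j a * ginv (schwarzschild m) x l b
          * (hess (schwarzschild m) f x a b - f x * ricci (schwarzschild m) x a b) =
        ∑ a, ∑ b, ginv (schwarzschild m) x j a * ginv (schwarzschild m) x l b
          * hess (schwarzschild m) f x a b - f x * ∑ a, ∑ b,
          ginv (schwarzschild m) x j a * ginv (schwarzschild m) x l b
          * ricci (schwarzschild m) x a b := by
      simp only [Finset.mul_sum, ← Finset.sum_sub_distrib]
      exact Finset.sum_congr rfl fun a _ => Finset.sum_congr rfl fun b _ => by ring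
    rw [tensorDiv_gradTensor hU hUe hx hf, staticUp, this]
    ring
  have e7 : ∑ i, ∑ j, ((-∑ a, ∑ b, ginv (schwarzschild m) x i a * h x a b
        * ginv (schwarzschild m) x b j) * ricci (schwarzschild m) x i j
        + ginv (schwarzschild m) x i j * varRicci (schwarzschild m) h x i j) =
      ∑ i, ∑ j, ginv (schwarzschild m) x i j * varRicci (schwarzschild m) h x i j
      - ∑ j, ∑ l, (∑ a, ∑ b, ginv (schwarzschild m) x j a * ginv (schwarzschild m) x l b
          * ricci (schwarzschild m) x a b) * h x j l := by
    have hG := ginv_schwarzschild_symm hxe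
    generalize ginv (schwarzschild m) x = G at hG
    generalize ricci (schwarzschild m) x = R
    generalize varRicci (schwarzschild m) h x = S
    have a0 := hG 1 0; have a1 := hG 2 0; have a2 := hG 2 1
    simp only [Fin.sum_univ_three, a0, a1, a2]
    ring
  rw [hsnd, DPhi_fst hg hh hxe, e5, e7]
  simp only [hP, Finset.sum_add_distrib, Finset.sum_sub_distrib, ← Finset.mul_sum]
  rw [← e1, ← e3, ← e4, e6, ← e2, adjointIntegrand]
  have e8 : ∑ k, pd k f x * (volDensity (schwarzschild m) x * varVec (schwarzschild m) h k x) =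
      volDensity (schwarzschild m) x * ∑ k, pd k f x * varVec (schwarzschild m) h k x := by
    rw [Finset.mul_sum]; exact Finset.sum_congr rfl fun k _ => by ring
  rw [e8]
  ring

theorem DPhi_pairing_off_tsupport (hx : x ∈ exterior m) (hh : IsSmoothSymm h)
    (hw : IsSmoothSymm w) (hxh : x ∉ tsupport h) (hxw : x ∉ tsupport w) :
    f x * (DPhi (schwarzschild m) 0 h w x).1
        + inner1 (schwarzschild m) x (X x) (DPhi (schwarzschild m) 0 h w x).2 = 0 := by
  have hg := isMetricOn_schwarzschild m
  rw [DPhi_fst hg hh hx]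
  simp [inner1, DPhi_snd hg hh hw hx, divergence_off_tsupport hxw, eq_zero_off_tsupport hxh,
    varRicci_off_tsupport hxh]

theorem flux_off_tsupport (g : Tensor2) (hxh : x ∉ tsupport h) (hxw : x ∉ tsupport w) (k : Fin 3) :
    flux g h w f X k x = 0 := by
  simp [flux, varVec_off_tsupport hxh, eq_zero_off_tsupport hxh, eq_zero_off_tsupport hxw]

theorem adjointIntegrand_off_tsupport (g : Tensor2) (hxh : x ∉ tsupport h) (hxw : x ∉ tsupport w) :
    adjointIntegrand g h w f X x = 0 := by
  simp [adjointIntegrand, eq_zero_off_tsupport hxh, eq_zero_off_tsupport hxw]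

theorem setIntegral_DPhi_pairing (hHm : MeasurableSet H) (hHe : H ⊆ exterior m)
    (hf : ContDiffOn ℝ ∞ f (interior H))
    (hX : ∀ i, ContDiffOn ℝ ∞ (fun y => X y i) (interior H)) (hh : IsTest H h) (hw : IsTest H w) :
    ∫ x in H, (f x * (DPhi (schwarzschild m) 0 h w x).1
        + inner1 (schwarzschild m) x (X x) (DPhi (schwarzschild m) 0 h w x).2)
        * volDensity (schwarzschild m) x =
      ∫ x, adjointIntegrand (schwarzschild m) h w f X x := by
  have hU : IsOpen (interior H) := isOpen_interior
  have hUe : interior H ⊆ exterior m := interior_subset.trans hHe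
  have hhs := hh.isSmoothSymm
  have hws := hw.isSmoothSymm
  have hK : IsCompact (tsupport h ∪ tsupport w) := hh.compact.isCompact.union hw.compact.isCompact
  have hKU : tsupport h ∪ tsupport w ⊆ interior H := Set.union_subset hh.support hw.support
  have hPs := flux_smooth hU hUe hhs hws hf hX
  have hQs := adjointIntegrand_smooth hU hUe hhs hws hf hX
  have hP0 : ∀ k, ∀ y ∉ tsupport h ∪ tsupport w, flux (schwarzschild m) h w f X k y = 0 :=
    fun k y hy => flux_off_tsupport _ (fun h1 => hy (.inl h1)) (fun h1 => hy (.inr h1)) k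
  have hQ0 : ∀ y ∉ tsupport h ∪ tsupport w, adjointIntegrand (schwarzschild m) h w f X y = 0 :=
    fun y hy => adjointIntegrand_off_tsupport _ (fun h1 => hy (.inl h1)) (fun h1 => hy (.inr h1))
  have hdP0 : ∀ k, ∀ y ∉ tsupport h ∪ tsupport w,
      pd k (flux (schwarzschild m) h w f X k) y = 0 :=
    fun k y hy => pd_eq_zero_of_compl hK.isClosed (hP0 k) hy k
  -- The Green formula is available only in the interior, but at the remaining points of `H` both
  -- sides vanish, the supports lying in the interior.
  have hcongr : ∀ x ∈ H, (f x * (DPhi (schwarzschild m) 0 h w x).1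
        + inner1 (schwarzschild m) x (X x) (DPhi (schwarzschild m) 0 h w x).2)
        * volDensity (schwarzschild m) x =
      ∑ k, pd k (flux (schwarzschild m) h w f X k) x
        + adjointIntegrand (schwarzschild m) h w f X x := by
    intro x hx
    by_cases hxK : x ∈ tsupport h ∪ tsupport w
    · exact DPhi_pairing_eq_div hU hUe (hKU hxK) hhs hws hf hX
    · rw [DPhi_pairing_off_tsupport (hHe hx) hhs hws (fun h1 => hxK (.inl h1))
        (fun h1 => hxK (.inr h1)), hQ0 x hxK, Finset.sum_eq_zero fun k _ => hdP0 k x hxK]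
      simp
  have hiP : ∀ k ∈ Finset.univ, Integrable (pd k (flux (schwarzschild m) h w f X k)) :=
    fun k _ => integrable_of_compl hU (smooth_pd hU (hPs k) k) hK hKU (hdP0 k)
  have hiQ := integrable_of_compl hU hQs hK hKU hQ0
  rw [setIntegral_congr_fun hHm hcongr, setIntegral_eq_integral_of_forall_compl_eq_zero,
    integral_add (integrable_finsetSum _ hiP) hiQ, integral_finsetSum _ hiP,
    Finset.sum_eq_zero fun k _ => integral_pd_eq_zero hU (hPs k) hK hKU (hP0 k) k, zero_add]
  intro x hx
  have hxK : x ∉ tsupport h ∪ tsupport w := fun h1 => hx (interior_subset (hKU h1))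
  rw [hQ0 x hxK, Finset.sum_eq_zero fun k _ => hdP0 k x hxK, zero_add]

/-! ### The fundamental lemma -/

/-- A scalar multiple of the symmetric elementary matrix. -/
def elemTensor (φ : E3 → ℝ) (a b : Fin 3) : Tensor2 := fun x => Matrix.of fun i j =>
  φ x * (kd i a * kd j b + kd i b * kd j a)

theorem isTest_elemTensor {φ : E3 → ℝ} (hφ : ContDiff ℝ ∞ φ) (hc : HasCompactSupport φ)
    (hs : tsupport φ ⊆ interior H) (a b : Fin 3) : IsTest H (elemTensor φ a b) := by
  have hsub : tsupport (elemTensor φ a b) ⊆ tsupport φ := by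
    refine closure_mono fun x hx => ?_
    rw [Function.mem_support] at hx ⊢
    contrapose! hx
    ext i j
    simp [elemTensor, hx]
  exact
  { symm := fun x i j => by simp only [elemTensor, Matrix.of_apply]; ring
    smooth := fun i j => hφ.mul contDiff_const
    compact := hc.of_isClosed_subset (isClosed_tsupport _) hsub
    support := hsub.trans hs }

theorem isTest_zero : IsTest H 0 where
  symm := fun _ _ _ => rfl
  smooth := fun _ _ => contDiff_const
  compact := HasCompactSupport.zero
  support := by simp [tsupport]

theorem sum_mul_elemTensor (S : Fin 3 → Fin 3 → ℝ) (φ : E3 → ℝ) (a b : Fin 3) (x : E3) :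
    ∑ j, ∑ l, S j l * elemTensor φ a b x j l = φ x * (S a b + S b a) := by
  simp only [elemTensor, Matrix.of_apply, Fin.sum_univ_three]
  fin_cases a <;> fin_cases b <;> simp [kd] <;> ring

/-- The fundamental lemma of the calculus of variations gives vanishing almost everywhere;
continuity on an open set upgrades it to every point. -/
theorem eqOn_zero_of_integral_eq_zero (hU : IsOpen U) {u : E3 → ℝ} (hu : ContDiffOn ℝ ∞ u U)
    (h : ∀ φ : E3 → ℝ, ContDiff ℝ ∞ φ → HasCompactSupport φ → tsupport φ ⊆ U →
      ∫ x, φ x * u x = 0) : ∀ x ∈ U, u x = 0 := by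
  have hae := hU.ae_eq_zero_of_integral_contDiff_smul_eq_zero (μ := (volume : Measure E3))
    (hu.continuousOn.locallyIntegrableOn hU.measurableSet) h
  have h2 : u =ᵐ[volume.restrict U] fun _ => (0 : ℝ) :=
    (ae_restrict_iff' hU.measurableSet).2 hae
  exact Measure.eqOn_open_of_ae_eq h2 hU hu.continuousOn continuousOn_const

/-- Symmetric test tensors detect only the symmetric part of a coefficient, hence the symmetrized
equations. Bump multiples of elementary symmetric matrices, placed in one slot at a time, separate
the components and decouple `f` from `X`. -/
theorem weak_iff_pointwise (hHm : MeasurableSet H) (hHe : H ⊆ exterior m)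
    (hf : ContDiffOn ℝ ∞ f (interior H))
    (hX : ∀ i, ContDiffOn ℝ ∞ (fun y => X y i) (interior H)) :
    (∀ h w, IsTest H h → IsTest H w → ∫ x in H, (f x * (DPhi (schwarzschild m) 0 h w x).1
        + inner1 (schwarzschild m) x (X x) (DPhi (schwarzschild m) 0 h w x).2)
        * volDensity (schwarzschild m) x = 0) ↔
      ∀ x ∈ interior H, ∀ a b,
        staticUp (schwarzschild m) f x a b + staticUp (schwarzschild m) f x b a = 0 ∧
        covUp (schwarzschild m) X x a b + covUp (schwarzschild m) X x b a = 0 := by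
  have hU : IsOpen (interior H) := isOpen_interior
  have hUe : interior H ⊆ exterior m := interior_subset.trans hHe
  have hV := (volDensity_schwarzschild_smooth (m := m)).mono hUe
  constructor
  · intro hz x hx a b
    have hV0 := (volDensity_schwarzschild_pos (hUe hx)).ne'
    constructor
    · have hs : ContDiffOn ℝ ∞ (fun x => volDensity (schwarzschild m) x *
          (staticUp (schwarzschild m) f x a b + staticUp (schwarzschild m) f x b a))
          (interior H) :=
        hV.mul ((staticUp_smooth hU hUe hf a b).add (staticUp_smooth hU hUe hf b a))
      refine (mul_eq_zero.1 (eqOn_zero_of_integral_eq_zero hU hs (fun φ hφ hc ht => ?_) x hx)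
        ).resolve_left hV0
      have h1 := isTest_elemTensor hφ hc ht a b
      have h2 := hz _ _ h1 isTest_zero
      rw [setIntegral_DPhi_pairing hHm hHe hf hX h1 isTest_zero] at h2
      rw [← h2]
      refine integral_congr_ae (Filter.Eventually.of_forall fun y => ?_)
      simp only [adjointIntegrand, sum_mul_elemTensor]
      simp
      ring
    · have hs : ContDiffOn ℝ ∞ (fun x => volDensity (schwarzschild m) x *
          (covUp (schwarzschild m) X x a b + covUp (schwarzschild m) X x b a))
          (interior H) :=
        hV.mul ((covUp_smooth hU hUe hX a b).add (covUp_smooth hU hUe hX b a))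
      refine (mul_eq_zero.1 (eqOn_zero_of_integral_eq_zero hU hs (fun φ hφ hc ht => ?_) x hx)
        ).resolve_left hV0
      have h1 := isTest_elemTensor hφ hc ht a b
      have h2 := hz _ _ isTest_zero h1
      rw [setIntegral_DPhi_pairing hHm hHe hf hX isTest_zero h1, ← neg_eq_zero,
        ← integral_neg] at h2
      rw [← h2]
      refine integral_congr_ae (Filter.Eventually.of_forall fun y => ?_)
      simp only [adjointIntegrand, sum_mul_elemTensor]
      simp
      ring
  · intro hz h w hh hw
    rw [setIntegral_DPhi_pairing hHm hHe hf hX hh hw]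
    have key : ∀ (S T : Fin 3 → Fin 3 → ℝ), (∀ a b, S a b + S b a = 0) → (∀ a b, T a b = T b a) →
        ∑ j, ∑ l, S j l * T j l = 0 := by
      intro S T hS hT
      have h1 : ∑ j, ∑ l, S j l * T j l = ∑ j, ∑ l, S l j * T j l := by
        rw [Finset.sum_comm]
        exact Finset.sum_congr rfl fun j _ => Finset.sum_congr rfl fun l _ => by rw [hT l j]
      have h2 : ∑ j, ∑ l, S j l * T j l + ∑ j, ∑ l, S l j * T j l = 0 := by
        simp only [← Finset.sum_add_distrib, ← add_mul, hS, zero_mul, Finset.sum_const_zero]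
      linarith
    have h0 : ∀ x, adjointIntegrand (schwarzschild m) h w f X x = 0 := by
      intro x
      by_cases hx : x ∈ interior H
      · rw [adjointIntegrand, key _ _ (fun a b => (hz x hx a b).1) (hh.symm x),
          key _ _ (fun a b => (hz x hx a b).2) (hw.symm x)]
        simp
      · exact adjointIntegrand_off_tsupport _ (fun h1 => hx (hh.support h1))
          (fun h1 => hx (hw.support h1))
    simp [h0]

end Weak

/-! ### The adjoint equations in Cartesian coordinates -/

section Equations

variable {m : ℝ} {U : Set E3} {x : E3} {f : E3 → ℝ} {X : E3 → Fin 3 → ℝ}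

theorem schwarzschild_mul_ginv (hx : x ∈ exterior m) :
    schwarzschild m x * (Matrix.of (ginv (schwarzschild m) x)) = 1 := by
  ext i j
  rw [Matrix.mul_apply]
  exact (sum_schwarzschild_mul_ginv hx i j).trans (by simp [kd, Matrix.one_apply])

theorem ginv_mul_schwarzschild (hx : x ∈ exterior m) :
    Matrix.of (ginv (schwarzschild m) x) * schwarzschild m x = 1 :=
  mul_eq_one_comm.1 (schwarzschild_mul_ginv hx)

theorem scalarCurv_schwarzschild (hx : x ∈ exterior m) : scalarCurv (schwarzschild m) x = 0 := by
  have h0 := norm_ne_zero_of_mem_exterior hx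
  have h1 := norm_sub_ne_zero_of_mem_exterior hx
  have h1' : ‖x‖ - m * 2 ≠ 0 := mul_comm 2 m ▸ h1
  have e : scalarCurv (schwarzschild m) x = schwAlpha m ‖x‖ * (3 - schwPhi m ‖x‖ * ‖x‖ ^ 2)
      + schwBeta m ‖x‖ * ‖x‖ ^ 2 * (1 - schwPhi m ‖x‖ * ‖x‖ ^ 2) := by
    simp only [scalarCurv, ginv_schwarzschild hx, ricci_schwarzschild hx, norm_sq_eq_sum,
      Fin.sum_univ_three]
    simp [kd]
    ring
  rw [e]
  simp only [schwAlpha, schwBeta, schwPhi]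
  field_simp
  ring

theorem hess_symm (hU : IsOpen U) (hUe : U ⊆ exterior m) (hx : x ∈ U)
    (hf : ContDiffOn ℝ ∞ f U) (a b : Fin 3) :
    hess (schwarzschild m) f x a b = hess (schwarzschild m) f x b a := by
  simp only [hess, pd_comm hU hf hx a b, christoffel_schwarzschild_symm (hUe hx) _ a b]

theorem ricci_symm (hx : x ∈ exterior m) (a b : Fin 3) :
    ricci (schwarzschild m) x a b = ricci (schwarzschild m) x b a := by
  rw [ricci_schwarzschild hx, ricci_schwarzschild hx, kd_comm]
  ring

/-- With `S = ∇²f - f Ric` and `t = Δf`, the equation reads `S = t g` after lowering indices. Since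
the scalar curvature vanishes, `tr S = t`, while tracing `t g` in dimension three gives `3t`; hence
`t = 0`. -/
theorem staticUp_eq_zero_iff (hU : IsOpen U) (hUe : U ⊆ exterior m) (hx : x ∈ U)
    (hf : ContDiffOn ℝ ∞ f U) :
    (∀ a b, staticUp (schwarzschild m) f x a b + staticUp (schwarzschild m) f x b a = 0) ↔
      ∀ a b, hess (schwarzschild m) f x a b = f x * ricci (schwarzschild m) x a b := by
  have hxe := hUe hx
  set G : Matrix (Fin 3) (Fin 3) ℝ := Matrix.of (ginv (schwarzschild m) x) with hGdef
  set S : Matrix (Fin 3) (Fin 3) ℝ := Matrix.of fun a b =>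
    hess (schwarzschild m) f x a b - f x * ricci (schwarzschild m) x a b with hSdef
  set t := ∑ a, ∑ b, ginv (schwarzschild m) x a b * hess (schwarzschild m) f x a b with ht
  have hR : ∑ a, ∑ b, ginv (schwarzschild m) x a b * ricci (schwarzschild m) x a b = 0 :=
    scalarCurv_schwarzschild hxe
  have htS : ∑ a, ∑ b, G a b * S a b = t := by
    have : ∑ a, ∑ b, G a b * S a b = t - f x *
        ∑ a, ∑ b, ginv (schwarzschild m) x a b * ricci (schwarzschild m) x a b := by
      simp only [ht, Finset.mul_sum, ← Finset.sum_sub_distrib]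
      refine Finset.sum_congr rfl fun a _ => Finset.sum_congr rfl fun b _ => ?_
      simp only [hGdef, hSdef, Matrix.of_apply]
      ring
    rw [this, hR]; ring
  have hUp : ∀ j l, staticUp (schwarzschild m) f x j l = (G * S * G - t • G) j l := by
    intro j l
    simp only [staticUp, Matrix.sub_apply, Matrix.smul_apply, Matrix.mul_apply, smul_eq_mul,
      ← ht, Finset.sum_mul]
    rw [Finset.sum_comm, mul_comm t]
    refine congrArg₂ _ (Finset.sum_congr rfl fun a _ => Finset.sum_congr rfl fun b _ => ?_) rfl
    rw [ginv_schwarzschild_symm hxe l]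
    simp only [hGdef, hSdef, Matrix.of_apply]
    ring
  have hsym : ∀ j l, staticUp (schwarzschild m) f x j l = staticUp (schwarzschild m) f x l j := by
    intro j l
    simp only [staticUp]
    rw [Finset.sum_comm, ginv_schwarzschild_symm hxe j l]
    refine congrArg₂ _ (Finset.sum_congr rfl fun a _ => Finset.sum_congr rfl fun b _ => ?_) rfl
    rw [hess_symm hU hUe hx hf b a, ricci_symm hxe b a]
    ring
  constructor
  · intro h
    have h0 : G * S * G - t • G = 0 := by
      ext j l
      rw [← hUp]
      have := h j l
      rw [hsym l j] at this
      simpa using this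
    have h1 : S = t • schwarzschild m x := by
      calc S = (schwarzschild m x * G) * S * (G * schwarzschild m x) := by
            rw [schwarzschild_mul_ginv hxe, ginv_mul_schwarzschild hxe, one_mul, mul_one]
        _ = schwarzschild m x * (G * S * G) * schwarzschild m x := by simp only [mul_assoc]
        _ = _ := by
          rw [sub_eq_zero.1 h0, mul_smul_comm, schwarzschild_mul_ginv hxe, smul_mul_assoc, one_mul]
    have h2 : ∑ a, ∑ b, G a b * S a b = 3 * t := by
      have : ∑ a, ∑ b, G a b * S a b =
          t * ∑ a, ∑ b, schwarzschild m x a b * ginv (schwarzschild m) x b a := by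
        simp only [h1, Finset.mul_sum]
        refine Finset.sum_congr rfl fun a _ => Finset.sum_congr rfl fun b _ => ?_
        rw [ginv_schwarzschild_symm hxe b a]
        simp only [hGdef, Matrix.of_apply, Matrix.smul_apply, smul_eq_mul]
        ring
      rw [this]
      simp only [sum_schwarzschild_mul_ginv hxe]
      simp [kd]
      ring
    have h3 : t = 0 := by linarith
    intro a b
    have := congrFun (congrFun h1 a) b
    rw [h3, zero_smul] at this
    exact sub_eq_zero.1 this
  · intro h a b
    have hS : S = 0 := by ext a b; exact sub_eq_zero.2 (h a b)
    have h3 : t = 0 := by rw [← htS, hS]; simp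
    rw [hUp, hUp, hS, h3]
    simp

theorem hess_eq_iff (hx : x ∈ exterior m) (a b : Fin 3) :
    hess (schwarzschild m) f x a b = f x * ricci (schwarzschild m) x a b ↔
      pd a (pd b f) x = (∑ k, x k * pd k f x)
          * (schwA m ‖x‖ * (x a * x b) + schwPhi m ‖x‖ * kd a b)
        + f x * (schwAlpha m ‖x‖ * kd a b + schwBeta m ‖x‖ * (x a * x b)) := by
  have e : ∑ k, christoffel (schwarzschild m) k a b x * pd k f x = (∑ k, x k * pd k f x)
      * (schwA m ‖x‖ * (x a * x b) + schwPhi m ‖x‖ * kd a b) := by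
    rw [Finset.sum_mul]
    refine Finset.sum_congr rfl fun k _ => ?_
    rw [christoffel_schwarzschild hx]
    ring
  rw [hess, e, ricci_schwarzschild hx, sub_eq_iff_eq_add, add_comm]

/-- Conjugating by `g` lowers the indices and gives `∇_a X_b + ∇_b X_a = 0`. The rank-one part of
`g` sees `X` only through `ξ = x · X`, so the equation is the Euclidean Killing equation plus terms
in `ξ` and `∇ξ`. -/
theorem covUp_eq_zero_iff (hU : IsOpen U) (hUe : U ⊆ exterior m) (hx : x ∈ U)
    (hX : ∀ i, ContDiffOn ℝ ∞ (fun y => X y i) U) :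
    (∀ a b, covUp (schwarzschild m) X x a b + covUp (schwarzschild m) X x b a = 0) ↔
      ∀ a b, pd a (fun y => X y b) x + pd b (fun y => X y a) x
        + schwPsi m ‖x‖ * (x b * pd a (fun y => ∑ k, y k * X y k) x
          + x a * pd b (fun y => ∑ k, y k * X y k) x)
        + schwPsi' m ‖x‖ * (∑ k, x k * X x k) * (x a * x b) = 0 := by
  have hxe := hUe hx
  have h0 := norm_ne_zero_of_mem_exterior hxe
  have h1 := norm_sub_ne_zero_of_mem_exterior hxe
  set G : Matrix (Fin 3) (Fin 3) ℝ := Matrix.of (ginv (schwarzschild m) x) with hGdef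
  set N : Matrix (Fin 3) (Fin 3) ℝ := Matrix.of fun i l =>
    pd i (fun y => X y l) x + ∑ n, christoffel (schwarzschild m) l i n x * X x n with hNdef
  have hξ : ∀ a, pd a (fun y => ∑ k, y k * X y k) x = X x a + ∑ k, x k * pd a (fun y => X y k) x := by
    intro a
    rw [(HasGrad.sum Finset.univ fun k _ => (hasGrad_coord k x).mul
      (hasGrad_of_smooth hU (hX k) hx)).pd_eq, Finset.sum_add_distrib, sum_kd_mul]
  -- Applying `g` to `x` multiplies it by `1 + ψ r²`; these two relations are what lowering the
  -- upper index of `Γ` requires.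
  have hψ1 : (1 + schwPsi m ‖x‖ * ‖x‖ ^ 2) * schwPhi m ‖x‖ = schwPsi m ‖x‖ := by
    linear_combination -schwPsi_sub_schwPhi hxe
  have hψ2 : (1 + schwPsi m ‖x‖ * ‖x‖ ^ 2) * schwA m ‖x‖ = schwPsi' m ‖x‖ / 2 := by
    rw [schwA_eq hxe]
    linear_combination (schwPsi' m ‖x‖ / 2) * ‖x‖ ^ 2 * schwPsi_sub_schwPhi hxe
  have hN : ∀ a b, (N * schwarzschild m x) a b = pd a (fun y => X y b) x
      + schwPsi m ‖x‖ * (x b * pd a (fun y => ∑ k, y k * X y k) x)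
      + schwPsi' m ‖x‖ / 2 * (∑ k, x k * X x k) * (x a * x b) := by
    intro a b
    have hn : ∀ l, N a l = pd a (fun y => X y l) x
        + x l * (schwA m ‖x‖ * x a * (∑ k, x k * X x k) + schwPhi m ‖x‖ * X x a) := by
      intro l
      simp only [hNdef, Matrix.of_apply, christoffel_schwarzschild hxe]
      congr 1
      calc _ = ∑ n, (x l * (schwA m ‖x‖ * x a) * (x n * X x n)
            + x l * schwPhi m ‖x‖ * (kd a n * X x n)) :=
          Finset.sum_congr rfl fun n _ => by ring
        _ = _ := by
          rw [Finset.sum_add_distrib, ← Finset.mul_sum, ← Finset.mul_sum, sum_kd_mul]; ring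
    have e : (N * schwarzschild m x) a b = pd a (fun y => X y b) x
        + schwPsi m ‖x‖ * x b * (∑ k, x k * pd a (fun y => X y k) x)
        + (1 + schwPsi m ‖x‖ * ‖x‖ ^ 2) * x b * (schwA m ‖x‖ * x a * (∑ k, x k * X x k)
          + schwPhi m ‖x‖ * X x a) := by
      rw [Matrix.mul_apply, ← sum_coord_mul_self]
      simp only [hn, schwarzschild_apply hxe]
      generalize schwA m ‖x‖ * x a * (∑ k, x k * X x k) + schwPhi m ‖x‖ * X x a = q
      simp only [Fin.sum_univ_three]
      fin_cases b <;> simp [kd] <;> ring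
    rw [e, hξ]
    linear_combination (x a * x b * ∑ k, x k * X x k) * hψ2 + (x b * X x a) * hψ1
  have hGs : G.transpose = G := by
    ext a b; exact ginv_schwarzschild_symm hxe b a
  have hgs : (schwarzschild m x).transpose = schwarzschild m x := by
    ext a b; exact schwarzschild_symm x b a
  have hK : ∀ a b, (N * schwarzschild m x + schwarzschild m x * N.transpose) a b =
      pd a (fun y => X y b) x + pd b (fun y => X y a) x
        + schwPsi m ‖x‖ * (x b * pd a (fun y => ∑ k, y k * X y k) x
          + x a * pd b (fun y => ∑ k, y k * X y k) x)
        + schwPsi' m ‖x‖ * (∑ k, x k * X x k) * (x a * x b) := by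
    intro a b
    have : schwarzschild m x * N.transpose = (N * schwarzschild m x).transpose := by
      rw [Matrix.transpose_mul, hgs]
    rw [this, Matrix.add_apply, Matrix.transpose_apply, hN, hN]
    ring
  have hC : ∀ a b, covUp (schwarzschild m) X x a b + covUp (schwarzschild m) X x b a =
      (G * N + N.transpose * G) a b := by
    intro a b
    have h2 : N.transpose * G = (G * N).transpose := by rw [Matrix.transpose_mul, hGs]
    have h3 : ∀ a b, covUp (schwarzschild m) X x a b = (G * N) a b := by
      intro a b
      rw [Matrix.mul_apply]
      refine Finset.sum_congr rfl fun i _ => ?_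
      rw [ginv_schwarzschild_symm hxe i a]
      rfl
    rw [h2, Matrix.add_apply, Matrix.transpose_apply, h3, h3]
  simp only [← hK, hC]
  have hgG : schwarzschild m x * G = 1 := schwarzschild_mul_ginv hxe
  have hGg : G * schwarzschild m x = 1 := ginv_mul_schwarzschild hxe
  constructor
  · intro h
    have h2 : G * N + N.transpose * G = 0 := by ext a b; exact h a b
    have h3 : N * schwarzschild m x + schwarzschild m x * N.transpose = 0 := by
      calc _ = schwarzschild m x * (G * N + N.transpose * G) * schwarzschild m x := by
            rw [mul_add, add_mul, ← mul_assoc _ G N, hgG, one_mul, ← mul_assoc, mul_assoc _ G, hGg,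
              mul_one]
        _ = 0 := by rw [h2]; simp
    intro a b; rw [h3]; rfl
  · intro h
    have h2 : N * schwarzschild m x + schwarzschild m x * N.transpose = 0 := by
      ext a b; exact h a b
    have h3 : G * N + N.transpose * G = 0 := by
      calc _ = G * (N * schwarzschild m x + schwarzschild m x * N.transpose) * G := by
            rw [mul_add, add_mul, ← mul_assoc _ (schwarzschild m x) _, hGg, one_mul, mul_assoc G,
              mul_assoc N, hgG, mul_one]
        _ = 0 := by rw [h2]; simp
    intro a b; rw [h3]; rfl

end Equations

/-! ### Static potentials -/

section Static

variable {m : ℝ} {U : Set E3} {x : E3} {f : E3 → ℝ}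

theorem schwAlpha_smooth : ContDiffOn ℝ ∞ (fun y => schwAlpha m ‖y‖) (exterior m) :=
  contDiffOn_const.div (norm_smooth.pow 3)
    fun _ hx => pow_ne_zero _ (norm_ne_zero_of_mem_exterior hx)

theorem schwBeta_smooth : ContDiffOn ℝ ∞ (fun y => schwBeta m ‖y‖) (exterior m) :=
  ((contDiffOn_const.mul ((contDiffOn_const.mul norm_smooth).sub contDiffOn_const)).neg).div
    ((norm_smooth.pow 5).mul (norm_smooth.sub contDiffOn_const))
    fun _ hx => mul_ne_zero (pow_ne_zero _ (norm_ne_zero_of_mem_exterior hx))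
      (norm_sub_ne_zero_of_mem_exterior hx)

theorem schwPhi_eq (m r : ℝ) : schwPhi m r = 2 * schwAlpha m r := by
  simp only [schwPhi, schwAlpha]; ring

theorem hasGrad_schwAlpha (hx : x ∈ exterior m) :
    HasGrad (fun y => schwAlpha m ‖y‖) (fun i => -3 * m / ‖x‖ ^ 5 * x i) x := by
  have h := (hasGrad_schwPhi hx).const_mul (1 / 2)
  simp only [schwPhi_eq, ← mul_assoc] at h
  simpa using h.congr_grad (D' := fun i => -3 * m / ‖x‖ ^ 5 * x i) fun i => by ring

theorem volDensity_mul_lapse (hx : x ∈ exterior m) :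
    volDensity (schwarzschild m) x * lapse m x = 1 := by
  have h0 := norm_ne_zero_of_mem_exterior hx
  have h1 := norm_sub_ne_zero_of_mem_exterior hx
  rw [volDensity_schwarzschild hx, lapse, ← Real.sqrt_mul (div_pos_of_mem_exterior hx).le,
    one_sub_div h0, div_mul_div_cancel₀ h1, div_self h0, Real.sqrt_one]

theorem lapse_eq_inv (hx : x ∈ exterior m) : lapse m x = (volDensity (schwarzschild m) x)⁻¹ :=
  eq_inv_of_mul_eq_one_right (volDensity_mul_lapse hx)

theorem lapse_smooth : ContDiffOn ℝ ∞ (lapse m) (exterior m) :=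
  (volDensity_schwarzschild_smooth.inv fun _ hx => (volDensity_schwarzschild_pos hx).ne').congr
    fun _ hx => lapse_eq_inv hx

theorem hasGrad_volDensity (hx : x ∈ exterior m) :
    HasGrad (volDensity (schwarzschild m))
      (fun k => -(volDensity (schwarzschild m) x * (schwPsi m ‖x‖ / 2) * x k)) x :=
  (hasGrad_of_smooth (isOpen_exterior m) volDensity_schwarzschild_smooth hx).congr_grad fun k => by
    rw [pd_volDensity_schwarzschild hx, sum_christoffel_trace hx]; ring

theorem hasGrad_lapse (hx : x ∈ exterior m) :
    HasGrad (lapse m) (fun k => lapse m x * (schwPsi m ‖x‖ / 2) * x k) x := by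
  have hl := hasGrad_of_smooth (isOpen_exterior m) lapse_smooth hx
  refine hl.congr_grad fun k => ?_
  have h1 := ((hasGrad_volDensity hx).mul hl).pd_eq k
  rw [pd_congr (isOpen_exterior m) (v := fun _ => 1) (fun y hy => volDensity_mul_lapse hy) hx,
    (HasGrad.const 1).pd_eq] at h1
  have hv := volDensity_mul_lapse hx
  have hv0 := (volDensity_schwarzschild_pos hx).ne'
  apply mul_left_cancel₀ hv0
  linear_combination -h1

theorem hess_lapse (hx : x ∈ exterior m) (a b : Fin 3) :
    hess (schwarzschild m) (lapse m) x a b = lapse m x * ricci (schwarzschild m) x a b := by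
  have h0 := norm_ne_zero_of_mem_exterior hx
  have h1 := norm_sub_ne_zero_of_mem_exterior hx
  have h1' : ‖x‖ - m * 2 ≠ 0 := mul_comm 2 m ▸ h1
  rw [hess_eq_iff hx]
  have hg : HasGrad (pd b (lapse m)) _ x :=
    (((hasGrad_lapse hx).mul ((hasGrad_schwPsi hx).const_mul (1 / 2))).mul
      (hasGrad_coord b x)).congr_on (isOpen_exterior m) hx fun y hy => by
        rw [(hasGrad_lapse hy).pd_eq]; ring
  have hD : ∑ k, x k * pd k (lapse m) x = lapse m x * (schwPsi m ‖x‖ / 2) * ‖x‖ ^ 2 := by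
    rw [← sum_coord_mul_self, Finset.mul_sum]
    refine Finset.sum_congr rfl fun k _ => ?_
    rw [(hasGrad_lapse hx).pd_eq]; ring
  rw [hg.pd_eq, hD]
  have e1 : schwPsi m ‖x‖ / 2 = schwPsi m ‖x‖ / 2 * ‖x‖ ^ 2 * schwPhi m ‖x‖ + schwAlpha m ‖x‖ := by
    simp only [schwPsi, schwPhi, schwAlpha]
    field_simp
    ring
  have e2 : (schwPsi m ‖x‖ / 2) ^ 2 + schwPsi' m ‖x‖ / 2 =
      schwPsi m ‖x‖ / 2 * ‖x‖ ^ 2 * schwA m ‖x‖ + schwBeta m ‖x‖ := by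
    simp only [schwPsi, schwPsi', schwA, schwBeta]
    field_simp
    ring
  linear_combination (lapse m x * kd a b) * e1 + (lapse m x * x a * x b) * e2

theorem kd_sum_eq (p : Fin 3 → ℝ) (k : Fin 3) :
    kd k 0 * p 0 + kd k 1 * p 1 + kd k 2 * p 2 = p k := by
  rw [← Fin.sum_univ_three (fun i => kd k i * p i), sum_kd_mul]

theorem kd_self (i : Fin 3) : kd i i = 1 := by simp [kd]

/-- The identity says that `p_k δ_ij + q_k v_i v_j` is symmetric in `k` and `i`. Its trace over `i,
j` (`h1`) and its contraction with `v_i v_j` (`h2`) are two linear relations modulo `v`; eliminating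
`q` leaves `p` parallel to `v`. -/
theorem parallel_of_codazzi {p q v : Fin 3 → ℝ} (hv : v 0 ^ 2 + v 1 ^ 2 + v 2 ^ 2 ≠ 0)
    (h : ∀ k i j, p k * kd i j + q k * (v i * v j) = p i * kd k j + q i * (v k * v j))
    (k l : Fin 3) : p k * v l = p l * v k := by
  set ρ := v 0 ^ 2 + v 1 ^ 2 + v 2 ^ 2 with hρ
  have h1 : ∀ k, 2 * p k + ρ * q k = (∑ i, q i * v i) * v k := by
    intro k
    have e := kd_sum_eq p k
    rw [Fin.sum_univ_three]
    have a0 := h k 0 0; have a1 := h k 1 1; have a2 := h k 2 2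
    rw [kd_self] at a0 a1 a2
    linear_combination a0 + a1 + a2 + e
  have h2 : ∀ k, ρ * p k + ρ ^ 2 * q k = (∑ i, p i * v i) * v k + ρ * (∑ i, q i * v i) * v k := by
    intro k
    have e : ∀ i, ∑ j, (p k * kd i j + q k * (v i * v j)) * v j =
        ∑ j, (p i * kd k j + q i * (v k * v j)) * v j := fun i =>
      Finset.sum_congr rfl fun j _ => by rw [h]
    have e' : ∀ i, p k * v i + q k * v i * ρ = p i * v k + q i * v k * ρ := by
      intro i
      have := e i
      simp only [Fin.sum_univ_three] at this
      have f1 := kd_sum_eq v i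
      have f2 := kd_sum_eq v k
      linear_combination this - p k * f1 + p i * f2
    rw [Fin.sum_univ_three, Fin.sum_univ_three]
    linear_combination v 0 * e' 0 + v 1 * e' 1 + v 2 * e' 2
  have h3 : ∀ k, ρ * p k = -(∑ i, p i * v i) * v k := by
    intro k
    linear_combination ρ * h1 k - h2 k
  apply mul_left_cancel₀ hv
  linear_combination v l * h3 k - v k * h3 l

theorem static_potential_eq (hU : IsOpen U) (hUc : IsPreconnected U) (hUe : U ⊆ exterior m)
    (hm : m ≠ 0) (hf : ContDiffOn ℝ ∞ f U)
    (hst : ∀ x ∈ U, ∀ a b, hess (schwarzschild m) f x a b = f x * ricci (schwarzschild m) x a b) :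
    ∃ c, ∀ x ∈ U, f x = c * lapse m x := by
  set D : E3 → ℝ := fun y => ∑ k, y k * pd k f y with hDdef
  set P : E3 → ℝ := fun y => schwPhi m ‖y‖ * D y + schwAlpha m ‖y‖ * f y with hPdef
  set Q : E3 → ℝ := fun y => schwA m ‖y‖ * D y + schwBeta m ‖y‖ * f y with hQdef
  have hfp := fun k => smooth_pd hU hf k
  have hDs : ContDiffOn ℝ ∞ D U := ContDiffOn.sum fun k _ => (coord_smooth U k).mul (hfp k)
  have hQs : ContDiffOn ℝ ∞ Q U :=
    ((schwA_smooth.mono hUe).mul hDs).add ((schwBeta_smooth.mono hUe).mul hf)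
  have hPs : ContDiffOn ℝ ∞ P U :=
    ((schwPhi_smooth.mono hUe).mul hDs).add ((schwAlpha_smooth.mono hUe).mul hf)
  have h2 : ∀ x ∈ U, ∀ a b, pd a (pd b f) x = P x * kd a b + Q x * (x a * x b) := by
    intro x hx a b
    rw [(hess_eq_iff (hUe hx) a b).1 (hst x hx a b)]
    simp only [hPdef, hQdef, hDdef]
    ring
  have hD : ∀ x ∈ U, HasGrad D (fun k => pd k f x + (P x + ‖x‖ ^ 2 * Q x) * x k) x := by
    intro x hx
    refine (HasGrad.sum Finset.univ fun k _ => (hasGrad_coord k x).mul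
      (hasGrad_of_smooth hU (hfp k) hx)).congr_grad fun k => ?_
    rw [Finset.sum_add_distrib, sum_kd_mul]
    simp only [h2 x hx]
    have : ∀ i, x i * (P x * kd k i + Q x * (x k * x i)) =
        P x * (x i * kd k i) + Q x * x k * (x i * x i) := fun i => by ring
    rw [Finset.sum_congr rfl fun i _ => this i, Finset.sum_add_distrib, ← Finset.mul_sum,
      ← Finset.mul_sum, sum_mul_kd, sum_coord_mul_self]
    ring
  have h3 : ∀ x ∈ U, ∀ k i j, pd k (pd i (pd j f)) x =
      pd k P x * kd i j + pd k Q x * (x i * x j) + Q x * (kd k i * x j + x i * kd k j) := by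
    intro x hx k i j
    have hg := (((hasGrad_of_smooth hU hPs hx).mul (HasGrad.const (kd i j))).add
      ((hasGrad_of_smooth hU hQs hx).mul ((hasGrad_coord i x).mul (hasGrad_coord j x)))).congr_on
      hU hx fun y hy => h2 y hy i j
    rw [hg.pd_eq]
    ring
  -- Commuting third derivatives makes `∇P - Q x` parallel to `x`. Modulo multiples of `x` it equals
  -- `(φ + α) ∇f = 3α ∇f`, and `α = m/r³ ≠ 0`. This is where nonzero mass is needed.
  have hpar : ∀ x ∈ U, ∀ k, ‖x‖ ^ 2 * pd k f x = D x * x k := by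
    intro x hx k
    have h0 := norm_ne_zero_of_mem_exterior (hUe hx)
    have hcod := parallel_of_codazzi (p := fun k => pd k P x - Q x * x k)
      (q := fun k => pd k Q x) (v := fun i => x i)
      (by rw [← norm_sq_eq_sum]; exact pow_ne_zero 2 h0) (fun k i j => by
        have := pd_comm hU (hfp j) hx k i
        rw [h3 x hx, h3 x hx, kd_comm i k] at this
        linear_combination this)
    have hPg : HasGrad P _ x := (((hasGrad_schwPhi (hUe hx)).mul (hD x hx)).add
      ((hasGrad_schwAlpha (hUe hx)).mul (hasGrad_of_smooth hU hf hx)))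
    have hl : ∀ l, pd k f x * x l = pd l f x * x k := by
      intro l
      have := hcod k l
      simp only [hPg.pd_eq, schwPhi_eq] at this
      have hα : schwAlpha m ‖x‖ ≠ 0 := div_ne_zero hm (pow_ne_zero 3 h0)
      have h3α : 3 * schwAlpha m ‖x‖ ≠ 0 := mul_ne_zero (by norm_num) hα
      apply mul_left_cancel₀ h3α
      linear_combination this
    rw [← sum_coord_mul_self, hDdef, Finset.sum_mul, Finset.sum_mul]
    exact Finset.sum_congr rfl fun l _ => by linear_combination x l * hl l
  -- Taking the Euclidean divergence of `r² ∇f = D x` compares tangential second derivatives: `Q`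
  -- drops out and `D = r² P` remains.
  have hDP : ∀ x ∈ U, D x = ‖x‖ ^ 2 * P x := by
    intro x hx
    have h0 := norm_ne_zero_of_mem_exterior (hUe hx)
    have hx0 := ne_zero_of_mem_exterior (hUe hx)
    have hr : HasGrad (fun y : E3 => ‖y‖ ^ 2) (fun i => 2 * x i) x :=
      (HasGrad.radial hx0 (hasDerivAt_pow 2 ‖x‖)).congr_grad fun i => by
        push_cast; field_simp
    have hd : ∀ i, 2 * x i * pd i f x + ‖x‖ ^ 2 * (P x + Q x * (x i * x i)) =
        (pd i f x + (P x + ‖x‖ ^ 2 * Q x) * x i) * x i + D x := by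
      intro i
      have e1 := (hr.mul (hasGrad_of_smooth hU (hfp i) hx)).pd_eq i
      rw [pd_congr hU (fun y hy => hpar y hy i) hx,
        ((hD x hx).mul (hasGrad_coord i x)).pd_eq i, h2 x hx, kd_self] at e1
      linear_combination -e1
    have e := norm_sq_eq_sum x
    have hs : D x = x 0 * pd 0 f x + x 1 * pd 1 f x + x 2 * pd 2 f x := by
      simp only [hDdef, Fin.sum_univ_three]
    linear_combination -(1 / 2) * (hd 0 + hd 1 + hd 2) - (1 / 2) * hs + (1 / 2) * P x * e
  -- The volume density is the reciprocal of the lapse, so `f` divided by the lapse is shown to have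
  -- zero gradient. The radial equation used is `(r - 2m) D = m f`.
  obtain ⟨c, hc⟩ := eq_const_of_pd_eq_zero (u := fun y => f y * volDensity (schwarzschild m) y)
    hU hUc (hf.mul (volDensity_schwarzschild_smooth.mono hUe)) (fun x hx k => by
      have hxe := hUe hx
      have h0 := norm_ne_zero_of_mem_exterior hxe
      have h1 := norm_sub_ne_zero_of_mem_exterior hxe
      have h1' : ‖x‖ - m * 2 ≠ 0 := mul_comm 2 m ▸ h1
      rw [((hasGrad_of_smooth hU hf hx).mul (hasGrad_volDensity hxe)).pd_eq]
      have e1 := hDP x hx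
      have e2 : D x * (‖x‖ - 2 * m) = m * f x := by
        simp only [hPdef, schwPhi, schwAlpha] at e1
        field_simp at e1
        linear_combination e1
      have e3 : pd k f x = f x * (schwPsi m ‖x‖ / 2) * x k := by
        have e4 := hpar x hx k
        have e5 : ‖x‖ ^ 2 * (‖x‖ - 2 * m) ≠ 0 := mul_ne_zero (pow_ne_zero 2 h0) h1
        apply mul_left_cancel₀ e5
        have e6 : ‖x‖ ^ 2 * (‖x‖ - 2 * m) * (schwPsi m ‖x‖ / 2) = m := by
          simp only [schwPsi]; field_simp
        linear_combination (‖x‖ - 2 * m) * e4 + x k * e2 - f x * x k * e6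
      rw [e3]
      ring)
  refine ⟨c, fun x hx => ?_⟩
  rw [← hc x hx, mul_assoc, volDensity_mul_lapse (hUe hx), mul_one]

end Static

/-! ### Killing fields -/

section Killing

variable {m : ℝ} {U : Set E3} {x : E3} {X : E3 → Fin 3 → ℝ}

/-- The homogeneity factor `κ` in `x · ∇ξ = κ ξ`. -/
def killKappa (m r : ℝ) : ℝ := (r - m) / (r - 2 * m)
/-- The function `κ' / r`. -/
def killKappa' (m r : ℝ) : ℝ := -m / (r * (r - 2 * m) ^ 2)
/-- The function `(κ' / r)' / r`. -/
def killKappa'' (m r : ℝ) : ℝ := m * (3 * r - 2 * m) / (r ^ 3 * (r - 2 * m) ^ 3)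
/-- The radial coefficient in the derivative of a Killing field along the position vector. -/
def killSigma (m r : ℝ) : ℝ := -(2 * m * (2 * r - 3 * m)) / (r ^ 2 * (r - 2 * m) ^ 2)
/-- The function `σ' / r`. -/
def killSigma' (m r : ℝ) : ℝ :=
  4 * m * (3 * r ^ 2 - 8 * m * r + 6 * m ^ 2) / (r ^ 4 * (r - 2 * m) ^ 3)
/-- The factor `Λ` in `Δξ = Λ ξ`. -/
def killLambda (m r : ℝ) : ℝ :=
  m * (8 * r ^ 2 - 29 * m * r + 24 * m ^ 2) / (r ^ 3 * (r - 2 * m) ^ 2)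
/-- The function `Λ' / r`. -/
def killLambda' (m r : ℝ) : ℝ :=
  m * (-24 * r ^ 3 + 132 * m * r ^ 2 - 236 * m ^ 2 * r + 144 * m ^ 3) / (r ^ 5 * (r - 2 * m) ^ 3)

theorem hasGrad_killKappa (hx : x ∈ exterior m) :
    HasGrad (fun y => killKappa m ‖y‖) (fun i => killKappa' m ‖x‖ * x i) x := by
  have h0 := norm_ne_zero_of_mem_exterior hx
  have h1 := norm_sub_ne_zero_of_mem_exterior hx
  have h1' : ‖x‖ - m * 2 ≠ 0 := mul_comm 2 m ▸ h1
  have h : HasDerivAt (killKappa m) _ ‖x‖ :=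
    ((hasDerivAt_id' ‖x‖).sub_const m).fun_div ((hasDerivAt_id' ‖x‖).sub_const (2 * m)) h1
  refine (HasGrad.radial (ne_zero_of_mem_exterior hx) h).congr_grad fun i => ?_
  simp only [killKappa']
  field_simp
  ring

theorem hasGrad_killKappa' (hx : x ∈ exterior m) :
    HasGrad (fun y => killKappa' m ‖y‖) (fun i => killKappa'' m ‖x‖ * x i) x := by
  have h0 := norm_ne_zero_of_mem_exterior hx
  have h1 := norm_sub_ne_zero_of_mem_exterior hx
  have h1' : ‖x‖ - m * 2 ≠ 0 := mul_comm 2 m ▸ h1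
  have h : HasDerivAt (killKappa' m) _ ‖x‖ :=
    (hasDerivAt_const ‖x‖ (-m)).fun_div
      ((hasDerivAt_id' ‖x‖).fun_mul (((hasDerivAt_id' ‖x‖).sub_const (2 * m)).fun_pow 2))
      (mul_ne_zero h0 (pow_ne_zero 2 h1))
  refine (HasGrad.radial (ne_zero_of_mem_exterior hx) h).congr_grad fun i => ?_
  simp only [killKappa'']
  push_cast
  field_simp
  ring

theorem hasGrad_killSigma (hx : x ∈ exterior m) :
    HasGrad (fun y => killSigma m ‖y‖) (fun i => killSigma' m ‖x‖ * x i) x := by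
  have h0 := norm_ne_zero_of_mem_exterior hx
  have h1 := norm_sub_ne_zero_of_mem_exterior hx
  have h1' : ‖x‖ - m * 2 ≠ 0 := mul_comm 2 m ▸ h1
  have h : HasDerivAt (killSigma m) _ ‖x‖ :=
    ((((hasDerivAt_id' ‖x‖).const_mul 2).sub_const (3 * m)).const_mul (2 * m)).fun_neg.fun_div
      (((hasDerivAt_id' ‖x‖).fun_pow 2).fun_mul
        (((hasDerivAt_id' ‖x‖).sub_const (2 * m)).fun_pow 2))
      (mul_ne_zero (pow_ne_zero 2 h0) (pow_ne_zero 2 h1))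
  refine (HasGrad.radial (ne_zero_of_mem_exterior hx) h).congr_grad fun i => ?_
  simp only [killSigma']
  push_cast
  field_simp
  ring

theorem hasGrad_killLambda (hx : x ∈ exterior m) :
    HasGrad (fun y => killLambda m ‖y‖) (fun i => killLambda' m ‖x‖ * x i) x := by
  have h0 := norm_ne_zero_of_mem_exterior hx
  have h1 := norm_sub_ne_zero_of_mem_exterior hx
  have h1' : ‖x‖ - m * 2 ≠ 0 := mul_comm 2 m ▸ h1
  have h : HasDerivAt (killLambda m) _ ‖x‖ :=
    (((((hasDerivAt_id' ‖x‖).fun_pow 2).const_mul 8).fun_sub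
      ((hasDerivAt_id' ‖x‖).const_mul (29 * m))).add_const (24 * m ^ 2) |>.const_mul m).fun_div
      (((hasDerivAt_id' ‖x‖).fun_pow 3).fun_mul
        (((hasDerivAt_id' ‖x‖).sub_const (2 * m)).fun_pow 2))
      (mul_ne_zero (pow_ne_zero 3 h0) (pow_ne_zero 2 h1))
  refine (HasGrad.radial (ne_zero_of_mem_exterior hx) h).congr_grad fun i => ?_
  simp only [killLambda']
  push_cast
  field_simp
  ring

/-- The commutator of the divergence with the Euler operator `x · ∇` is the divergence itself. It is
applied below to `X` and then to `∇ξ`. -/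
theorem sum_pd_euler (hU : IsOpen U) (hx : x ∈ U) {u : Fin 3 → E3 → ℝ}
    (hu : ∀ j, ContDiffOn ℝ ∞ (u j) U) :
    ∑ j, pd j (fun y => ∑ i, y i * pd i (u j) y) x =
      ∑ j, pd j (u j) x + ∑ i, x i * pd i (fun y => ∑ j, pd j (u j) y) x := by
  have h1 : ∀ j, pd j (fun y => ∑ i, y i * pd i (u j) y) x =
      pd j (u j) x + ∑ i, x i * pd i (pd j (u j)) x := by
    intro j
    rw [(HasGrad.sum Finset.univ fun i _ => (hasGrad_coord i x).mul
      (hasGrad_of_smooth hU (smooth_pd hU (hu j) i) hx)).pd_eq, Finset.sum_add_distrib, sum_kd_mul]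
    congr 1
    exact Finset.sum_congr rfl fun i _ => by rw [pd_comm hU (hu j) hx]
  have h2 : ∀ i, pd i (fun y => ∑ j, pd j (u j) y) x = ∑ j, pd i (pd j (u j)) x := fun i =>
    (HasGrad.sum Finset.univ fun j _ => hasGrad_of_smooth hU (smooth_pd hU (hu j) j) hx).pd_eq i
  simp only [h1, h2, Finset.sum_add_distrib, Finset.mul_sum]
  rw [Finset.sum_comm]

/-- The Killing system is overdetermined for `ξ`: its contractions with `x` and its trace express `x
· ∇ξ`, `div X` and `x · ∇X` through `ξ` and `∇ξ`, together with `X` itself in the last. Two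
applications of the Euler commutator then yield an algebraic equation for `ξ` with coefficient
proportional to `m`. -/
theorem radial_component_eq_zero (hU : IsOpen U) (hUe : U ⊆ exterior m) (hm : m ≠ 0)
    (hX : ∀ i, ContDiffOn ℝ ∞ (fun y => X y i) U) {ξ : E3 → ℝ}
    (hξ : ∀ y, ξ y = ∑ k, y k * X y k)
    (hK : ∀ x ∈ U, ∀ a b, pd a (fun y => X y b) x + pd b (fun y => X y a) x
        + schwPsi m ‖x‖ * (x b * pd a ξ x + x a * pd b ξ x)
        + schwPsi' m ‖x‖ * ξ x * (x a * x b) = 0) :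
    ∀ x ∈ U, ξ x = 0 := by
  have hξs : ContDiffOn ℝ ∞ ξ U :=
    (ContDiffOn.sum fun k _ => (coord_smooth U k).mul (hX k)).congr fun y _ => hξ y
  have hξp := fun i => smooth_pd hU hξs i
  have hξd : ∀ x ∈ U, ∀ a, pd a ξ x = X x a + ∑ k, x k * pd a (fun y => X y k) x := by
    intro x hx a
    rw [((HasGrad.sum Finset.univ fun k _ => (hasGrad_coord k x).mul
      (hasGrad_of_smooth hU (hX k) hx)).congr_on hU hx fun y _ => hξ y).pd_eq,
      Finset.sum_add_distrib, sum_kd_mul]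
  have hY : ∀ x ∈ U, ∀ j, ∑ i, x i * pd i (fun y => X y j) x =
      X x j - (1 + schwPsi m ‖x‖ * ‖x‖ ^ 2) * pd j ξ x
        - (schwPsi m ‖x‖ * (∑ i, x i * pd i ξ x) + schwPsi' m ‖x‖ * ‖x‖ ^ 2 * ξ x) * x j := by
    intro x hx j
    have e := norm_sq_eq_sum x
    have e1 := hξd x hx j
    simp only [Fin.sum_univ_three] at e1 ⊢
    linear_combination x 0 * hK x hx 0 j + x 1 * hK x hx 1 j + x 2 * hK x hx 2 j + e1
      + (schwPsi m ‖x‖ * pd j ξ x + schwPsi' m ‖x‖ * ξ x * x j) * e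
  -- The Killing equation contracted twice with `x`. The factor `κ` is the logarithmic radial
  -- derivative of `r (1 - 2m/r)^{1/2}`.
  have hD : ∀ x ∈ U, ∑ i, x i * pd i ξ x = killKappa m ‖x‖ * ξ x := by
    intro x hx
    have h0 := norm_ne_zero_of_mem_exterior (hUe hx)
    have h1 := norm_sub_ne_zero_of_mem_exterior (hUe hx)
    have h1' : ‖x‖ - m * 2 ≠ 0 := mul_comm 2 m ▸ h1
    have e := norm_sq_eq_sum x
    have e1 := hξd x hx
    have e2 := hY x hx
    have e3 := hξ x
    set d := ∑ i, x i * pd i ξ x with hd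
    have key : 2 * (1 + schwPsi m ‖x‖ * ‖x‖ ^ 2) * d =
        (2 - schwPsi' m ‖x‖ * ‖x‖ ^ 4) * ξ x := by
      simp only [Fin.sum_univ_three] at e1 e2 e3 hd
      linear_combination x 0 * e2 0 + x 1 * e2 1 + x 2 * e2 2 + x 0 * e1 0 + x 1 * e1 1
        + x 2 * e1 2 + (2 + schwPsi m ‖x‖ * ‖x‖ ^ 2) * hd - 2 * e3
        + (schwPsi m ‖x‖ * d + schwPsi' m ‖x‖ * ‖x‖ ^ 2 * ξ x) * e
    have f1 : 1 + schwPsi m ‖x‖ * ‖x‖ ^ 2 = ‖x‖ / (‖x‖ - 2 * m) := by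
      simp only [schwPsi]; field_simp; ring
    have f2 : 2 - schwPsi' m ‖x‖ * ‖x‖ ^ 4 =
        2 * (‖x‖ / (‖x‖ - 2 * m)) * killKappa m ‖x‖ := by
      simp only [schwPsi', killKappa]; field_simp; ring
    rw [f1, f2, mul_assoc _ (killKappa m ‖x‖)] at key
    exact mul_left_cancel₀ (mul_ne_zero two_ne_zero (div_ne_zero h0 h1)) key
  have hdiv : ∀ x ∈ U, ∑ j, pd j (fun y => X y j) x = schwPsi m ‖x‖ / 2 * ξ x := by
    intro x hx
    have h0 := norm_ne_zero_of_mem_exterior (hUe hx)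
    have h1 := norm_sub_ne_zero_of_mem_exterior (hUe hx)
    have h1' : ‖x‖ - m * 2 ≠ 0 := mul_comm 2 m ▸ h1
    have e := norm_sq_eq_sum x
    have e1 := hD x hx
    have f : -(schwPsi m ‖x‖ * killKappa m ‖x‖) - schwPsi' m ‖x‖ * ‖x‖ ^ 2 / 2 =
        schwPsi m ‖x‖ / 2 := by
      simp only [schwPsi, schwPsi', killKappa]; field_simp; ring
    simp only [Fin.sum_univ_three] at e1 ⊢
    linear_combination (1 / 2) * (hK x hx 0 0 + hK x hx 1 1 + hK x hx 2 2) - schwPsi m ‖x‖ * e1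
      + ξ x * f + schwPsi' m ‖x‖ * ξ x / 2 * e
  have hY' : ∀ x ∈ U, ∀ j, ∑ i, x i * pd i (fun y => X y j) x =
      X x j - (2 * killKappa m ‖x‖ - 1) * pd j ξ x - killSigma m ‖x‖ * (ξ x * x j) := by
    intro x hx j
    have h0 := norm_ne_zero_of_mem_exterior (hUe hx)
    have h1 := norm_sub_ne_zero_of_mem_exterior (hUe hx)
    have h1' : ‖x‖ - m * 2 ≠ 0 := mul_comm 2 m ▸ h1
    have f1 : 1 + schwPsi m ‖x‖ * ‖x‖ ^ 2 = 2 * killKappa m ‖x‖ - 1 := by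
      simp only [schwPsi, killKappa]; field_simp; ring
    have f2 : schwPsi m ‖x‖ * killKappa m ‖x‖ + schwPsi' m ‖x‖ * ‖x‖ ^ 2 =
        killSigma m ‖x‖ := by
      simp only [schwPsi, schwPsi', killKappa, killSigma]; field_simp; ring
    rw [hY x hx, hD x hx, f1, ← f2]
    ring
  -- Divergence of `hY'`: the two copies of `div X` cancel, and `Δξ` appears with the nonzero
  -- coefficient `2κ - 1 = r/(r - 2m)`.
  have hlap : ∀ x ∈ U, ∑ j, pd j (pd j ξ) x = killLambda m ‖x‖ * ξ x := by
    intro x hx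
    have hxe := hUe hx
    have h0 := norm_ne_zero_of_mem_exterior hxe
    have h1 := norm_sub_ne_zero_of_mem_exterior hxe
    have h1' : ‖x‖ - m * 2 ≠ 0 := mul_comm 2 m ▸ h1
    have hξg := hasGrad_of_smooth hU hξs hx
    have e1 := sum_pd_euler hU hx hX
    have e2 : ∀ i, pd i (fun y => ∑ j, pd j (fun z => X z j) y) x =
        schwPsi' m ‖x‖ / 2 * x i * ξ x + schwPsi m ‖x‖ / 2 * pd i ξ x := by
      intro i
      rw [((((hasGrad_schwPsi hxe).const_mul (1 / 2)).mul hξg).congr_on hU hx fun y hy => by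
        rw [hdiv y hy]; ring).pd_eq]
      ring
    have e3 : ∀ j, pd j (fun y => ∑ i, y i * pd i (fun z => X z j) y) x =
        pd j (fun z => X z j) x - (2 * (killKappa' m ‖x‖ * x j) * pd j ξ x
          + (2 * killKappa m ‖x‖ - 1) * pd j (pd j ξ) x)
        - (killSigma' m ‖x‖ * x j * (ξ x * x j)
          + killSigma m ‖x‖ * (pd j ξ x * x j + ξ x)) := by
      intro j
      rw [((((hasGrad_of_smooth hU (hX j) hx).sub
        ((((hasGrad_killKappa hxe).const_mul 2).sub (HasGrad.const 1)).mul
          (hasGrad_of_smooth hU (hξp j) hx))).sub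
        ((hasGrad_killSigma hxe).mul (hξg.mul (hasGrad_coord j x)))).congr_on hU hx
          fun y hy => hY' y hy j).pd_eq, kd_self]
      ring
    simp only [e2, e3] at e1
    have e4 := hD x hx
    have e := norm_sq_eq_sum x
    have f : -(schwPsi' m ‖x‖ / 2 * ‖x‖ ^ 2 + schwPsi m ‖x‖ / 2 * killKappa m ‖x‖
        + 2 * killKappa' m ‖x‖ * killKappa m ‖x‖ + killSigma' m ‖x‖ * ‖x‖ ^ 2
        + killSigma m ‖x‖ * killKappa m ‖x‖ + 3 * killSigma m ‖x‖) =
        (2 * killKappa m ‖x‖ - 1) * killLambda m ‖x‖ := by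
      simp only [schwPsi, schwPsi', killKappa, killKappa', killSigma, killSigma', killLambda]
      field_simp
      ring
    have hω : 2 * killKappa m ‖x‖ - 1 ≠ 0 := by
      have : 2 * killKappa m ‖x‖ - 1 = ‖x‖ / (‖x‖ - 2 * m) := by
        simp only [killKappa]; field_simp; ring
      rw [this]; exact div_ne_zero h0 h1
    apply mul_left_cancel₀ hω
    simp only [Fin.sum_univ_three] at e1 e4 ⊢
    linear_combination -e1 + ξ x * f
      - (2 * killKappa' m ‖x‖ + killSigma m ‖x‖ + schwPsi m ‖x‖ / 2) * e4
      + ξ x * (schwPsi' m ‖x‖ / 2 + killSigma' m ‖x‖) * e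
  intro x hx
  have hxe := hUe hx
  have h0 := norm_ne_zero_of_mem_exterior hxe
  have h1 := norm_sub_ne_zero_of_mem_exterior hxe
  have h1' : ‖x‖ - m * 2 ≠ 0 := mul_comm 2 m ▸ h1
  have hξg := hasGrad_of_smooth hU hξs hx
  have e1 := sum_pd_euler hU hx hξp
  have e2 : ∀ i, pd i (fun y => ∑ j, pd j (pd j ξ) y) x =
      killLambda' m ‖x‖ * x i * ξ x + killLambda m ‖x‖ * pd i ξ x := fun i =>
    (((hasGrad_killLambda hxe).mul hξg).congr_on hU hx hlap).pd_eq i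
  have hE : ∀ y ∈ U, ∀ j, ∑ i, y i * pd i (pd j ξ) y =
      (killKappa m ‖y‖ - 1) * pd j ξ y + killKappa' m ‖y‖ * (y j * ξ y) := by
    intro y hy j
    have g1 := (HasGrad.sum Finset.univ fun i _ => (hasGrad_coord i y).mul
      (hasGrad_of_smooth hU (hξp i) hy)).pd_eq j
    rw [pd_congr hU hD hy, ((hasGrad_killKappa (hUe hy)).mul
      (hasGrad_of_smooth hU hξs hy)).pd_eq j, Finset.sum_add_distrib, sum_kd_mul] at g1
    have g2 : ∑ i, y i * pd i (pd j ξ) y = ∑ i, y i * pd j (pd i ξ) y :=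
      Finset.sum_congr rfl fun i _ => by rw [pd_comm hU hξs hy i j]
    rw [g2]
    linear_combination -g1
  have e3 : ∀ j, pd j (fun y => ∑ i, y i * pd i (pd j ξ) y) x =
      killKappa' m ‖x‖ * x j * pd j ξ x + (killKappa m ‖x‖ - 1) * pd j (pd j ξ) x
        + (killKappa'' m ‖x‖ * x j * (x j * ξ x)
          + killKappa' m ‖x‖ * (ξ x + x j * pd j ξ x)) := by
    intro j
    rw [(((((hasGrad_killKappa hxe).sub (HasGrad.const 1)).mul
      (hasGrad_of_smooth hU (hξp j) hx)).add
      ((hasGrad_killKappa' hxe).mul ((hasGrad_coord j x).mul hξg))).congr_on hU hx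
        fun y hy => hE y hy j).pd_eq, kd_self]
    ring
  simp only [e2, e3] at e1
  have e4 := hD x hx
  have e5 := hlap x hx
  have e := norm_sq_eq_sum x
  -- Compatibility of `x · ∇ξ = κ ξ` with `Δξ = Λ ξ` requires this coefficient times `ξ` to vanish;
  -- it simplifies to `-6m/r³`.
  have f : 2 * killLambda m ‖x‖ + ‖x‖ ^ 2 * killLambda' m ‖x‖ - 3 * killKappa' m ‖x‖
      - ‖x‖ ^ 2 * killKappa'' m ‖x‖ - 2 * killKappa' m ‖x‖ * killKappa m ‖x‖ =
      -6 * m / ‖x‖ ^ 3 := by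
    simp only [killKappa, killKappa', killKappa'', killLambda, killLambda']
    field_simp
    ring
  have hne : -6 * m / ‖x‖ ^ 3 ≠ 0 :=
    div_ne_zero (mul_ne_zero (by norm_num) hm) (pow_ne_zero 3 h0)
  apply mul_left_cancel₀ hne
  simp only [Fin.sum_univ_three] at e1 e4 e5
  linear_combination -ξ x * f - e1 + (2 * killKappa' m ‖x‖ - killLambda m ‖x‖) * e4
    + (killKappa m ‖x‖ - 2) * e5 + ξ x * (killLambda' m ‖x‖ - killKappa'' m ‖x‖) * e

/-- A Euclidean Killing field is affine with antisymmetric linear part; tangency to the spheres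
removes the translation. -/
theorem euclidean_killing_tangent (hU : IsOpen U) (hUc : IsPreconnected U)
    (hX : ∀ i, ContDiffOn ℝ ∞ (fun y => X y i) U)
    (hK : ∀ x ∈ U, ∀ a b, pd a (fun y => X y b) x + pd b (fun y => X y a) x = 0)
    (hξ : ∀ x ∈ U, ∑ k, x k * X x k = 0) :
    ∃ c₁ c₂ c₃ : ℝ, ∀ x ∈ U, X x = c₁ • rot1 x + c₂ • rot2 x + c₃ • rot3 x := by
  have hs : ∀ x ∈ U, ∀ c a b, pd c (pd a (fun y => X y b)) x = -pd c (pd b (fun y => X y a)) x := by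
    intro x hx c a b
    have e := pd_congr hU (u := fun y => pd a (fun z => X z b) y + pd b (fun z => X z a) y)
      (v := fun _ => 0) (fun y hy => hK y hy a b) hx c
    rw [((hasGrad_of_smooth hU (smooth_pd hU (hX b) a) hx).add
      (hasGrad_of_smooth hU (smooth_pd hU (hX a) b) hx)).pd_eq, (HasGrad.const 0).pd_eq] at e
    linarith
  -- `∂_c ∂_a X_b` is symmetric in `c, a` and antisymmetric in `a, b`, so alternating the two swaps
  -- makes it equal to its own negative.
  have hz : ∀ x ∈ U, ∀ c a b, pd c (pd a (fun y => X y b)) x = 0 := by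
    intro x hx c a b
    have e1 := hs x hx c a b
    have e2 := pd_comm hU (hX a) hx c b
    have e3 := hs x hx b c a
    have e4 := pd_comm hU (hX c) hx b a
    have e5 := hs x hx a b c
    have e6 := pd_comm hU (hX b) hx a c
    linarith
  choose A hA using fun a b => eq_const_of_pd_eq_zero hU hUc (smooth_pd hU (hX b) a)
    fun x hx c => hz x hx c a b
  refine ⟨A 1 2, -A 0 2, A 0 1, fun x hx => ?_⟩
  -- Differentiating `x · X = 0` recovers `X` from its constant derivative matrix `A`, with no
  -- additive constant.
  have hXi : ∀ i, X x i = -∑ k, x k * A i k := by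
    intro i
    have e := pd_congr hU (u := fun y => ∑ k, y k * X y k) (v := fun _ => 0) hξ hx i
    rw [(HasGrad.sum Finset.univ fun k _ => (hasGrad_coord k x).mul
      (hasGrad_of_smooth hU (hX k) hx)).pd_eq, (HasGrad.const 0).pd_eq, Finset.sum_add_distrib,
      sum_kd_mul] at e
    simp only [hA _ _ x hx] at e
    linarith
  have hanti : ∀ a b, A a b = -A b a := by
    intro a b
    have := hK x hx a b
    rw [hA a b x hx, hA b a x hx] at this
    linarith
  have d0 := hanti 0 0; have d1 := hanti 1 1; have d2 := hanti 2 2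
  have s0 := hanti 1 0; have s1 := hanti 2 0; have s2 := hanti 2 1
  ext i
  rw [hXi, Fin.sum_univ_three]
  fin_cases i
  · simp [rot1, rot2, rot3]
    linear_combination -(x 0 / 2) * d0
  · simp [rot1, rot2, rot3]
    linear_combination -(x 1 / 2) * d1 - x 0 * s0
  · simp [rot1, rot2, rot3]
    linear_combination -(x 2 / 2) * d2 - x 0 * s1 - x 1 * s2

theorem killing_eq (hU : IsOpen U) (hUc : IsPreconnected U) (hUe : U ⊆ exterior m) (hm : m ≠ 0)
    (hX : ∀ i, ContDiffOn ℝ ∞ (fun y => X y i) U)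
    (hK : ∀ x ∈ U, ∀ a b, covUp (schwarzschild m) X x a b + covUp (schwarzschild m) X x b a = 0) :
    ∃ c₁ c₂ c₃ : ℝ, ∀ x ∈ U, X x = c₁ • rot1 x + c₂ • rot2 x + c₃ • rot3 x := by
  have hK' := fun x hx => (covUp_eq_zero_iff hU hUe hx hX).1 (hK x hx)
  have hξ := radial_component_eq_zero hU hUe hm hX (ξ := fun y => ∑ k, y k * X y k)
    (fun _ => rfl) hK'
  refine euclidean_killing_tangent hU hUc hX (fun x hx a b => ?_) hξ
  have h := hK' x hx a b
  have hp : ∀ i, pd i (fun y : E3 => ∑ k, y k * X y k) x = 0 := fun i => by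
    rw [pd_congr hU (v := fun _ => 0) hξ hx i, (HasGrad.const 0).pd_eq]
  have hξx : ∑ k, x k * X x k = 0 := hξ x hx
  rw [hp, hp, hξx] at h
  simpa using h

end Killing

/-! ### The kernel on a spherical shell -/

section Shell

variable {m : ℝ} {I : Set ℝ}

theorem shell_subset_exterior (hpos : ∀ r ∈ I, 0 < r) (hout : ∀ r ∈ I, 2 * m < r) :
    shell I ⊆ exterior m := fun _ hx => ⟨hpos _ hx, hout _ hx⟩

theorem measurableSet_shell (hI : I.OrdConnected) : MeasurableSet (shell I) :=
  measurable_norm hI.measurableSet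

theorem isOpen_shell_interior (I : Set ℝ) : IsOpen (shell (interior I)) :=
  isOpen_interior.preimage continuous_norm

theorem shell_interior_subset (I : Set ℝ) : shell (interior I) ⊆ interior (shell I) :=
  interior_maximal (fun _ hx => interior_subset (s := I) hx) (isOpen_shell_interior I)

/-- The shell is the image of `I × S²` under scaling, and the sphere is connected because the
ambient dimension exceeds one. -/
theorem isPreconnected_shell (hI : I.OrdConnected) (hpos : ∀ r ∈ I, 0 < r) :
    IsPreconnected (shell I) := by
  have hrank : 1 < Module.rank ℝ E3 := by
    rw [rank_eq_card_basis (EuclideanSpace.basisFun (Fin 3) ℝ).toBasis]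
    norm_num
  have hs : IsPreconnected (I ×ˢ Metric.sphere (0 : E3) 1) :=
    hI.isPreconnected.prod (isPreconnected_sphere hrank 0 1)
  have himg : shell I = (fun q : ℝ × E3 => q.1 • q.2) '' (I ×ˢ Metric.sphere (0 : E3) 1) := by
    ext x
    constructor
    · intro hx
      have h0 : ‖x‖ ≠ 0 := (hpos _ hx).ne'
      refine ⟨(‖x‖, ‖x‖⁻¹ • x), ⟨hx, ?_⟩, smul_inv_smul₀ h0 x⟩
      simp [norm_smul, h0]
    · rintro ⟨⟨r, v⟩, ⟨hr, hv⟩, rfl⟩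
      have hv1 : ‖v‖ = 1 := by simpa using hv
      show ‖r • v‖ ∈ I
      rw [norm_smul, hv1, mul_one, Real.norm_of_nonneg (hpos r hr).le]
      exact hr
  rw [himg]
  exact hs.image _ (continuous_fst.smul continuous_snd).continuousOn

/-- An interval with nonempty interior lies in the closure of its interior; scaling along the ray
through `x` transfers this to the shell. -/
theorem shell_subset_closure (hI : I.OrdConnected) (hne : (interior I).Nonempty)
    (hpos : ∀ r ∈ I, 0 < r) : shell I ⊆ closure (shell (interior I)) := by
  intro x hx
  have h0 : ‖x‖ ≠ 0 := (hpos _ hx).ne'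
  have hc : ‖x‖ ∈ closure (interior I) := by
    rw [(hI.convex (𝕜 := ℝ)).closure_interior_eq_closure_of_nonempty_interior hne]
    exact subset_closure hx
  have hmap : Set.MapsTo (fun ρ : ℝ => ρ • (‖x‖⁻¹ • x)) (interior I) (shell (interior I)) := by
    intro ρ hρ
    show ‖ρ • (‖x‖⁻¹ • x)‖ ∈ interior I
    rw [norm_smul, norm_smul, norm_inv, norm_norm, inv_mul_cancel₀ h0, mul_one,
      Real.norm_of_nonneg (hpos ρ (interior_subset hρ)).le]
    exact hρ
  have := map_mem_closure (by fun_prop : Continuous fun ρ : ℝ => ρ • (‖x‖⁻¹ • x)) hc hmap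
  simpa [smul_inv_smul₀ h0] using this

theorem adjointEq_zero_iff {H : Set E3} (hHm : MeasurableSet H) {f : H → ℝ}
    {X : H → Fin 3 → ℝ} {F : E3 → ℝ} {Y : E3 → Fin 3 → ℝ} (hF : ∀ x : H, f x = F x)
    (hY : ∀ x : H, X x = Y x) :
    AdjointEq H (schwarzschild m) 0 f X 0 0 ↔
      ∀ h w, IsTest H h → IsTest H w → ∫ x in H, (F x * (DPhi (schwarzschild m) 0 h w x).1
        + inner1 (schwarzschild m) x (Y x) (DPhi (schwarzschild m) 0 h w x).2)
        * volDensity (schwarzschild m) x = 0 := by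
  refine forall_congr' fun h => forall_congr' fun w => forall_congr' fun _ =>
    forall_congr' fun _ => ?_
  simp only [hF, hY]
  rw [integral_subtype_comap hHm (fun x => (F x * (DPhi (schwarzschild m) 0 h w x).1
        + inner1 (schwarzschild m) x (Y x) (DPhi (schwarzschild m) 0 h w x).2)
        * volDensity (schwarzschild m) x)]
  simp [inner2]

theorem smoothOn_iff {V : Type} [NormedAddCommGroup V] [NormedSpace ℝ V] {H : Set E3} {u : H → V}
    {F : E3 → V} (hF : ∀ x : H, u x = F x) : SmoothOn H u ↔ ContDiffOn ℝ ∞ F H := by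
  refine contDiffOn_congr fun x hx => ?_
  rw [Subtype.val_injective.extend_apply u 0 ⟨x, hx⟩, hF]

/-- The representatives `F`, `Y` on all of space are arbitrary off `H`: one direction of the final
characterization takes extensions by zero, the other the explicit fields. -/
theorem mem_kerAdjoint_iff {H : Set E3} (hHm : MeasurableSet H) (hHe : H ⊆ exterior m)
    {f : H → ℝ} {X : H → Fin 3 → ℝ} {F : E3 → ℝ} {Y : E3 → Fin 3 → ℝ} (hF : ∀ x : H, f x = F x)
    (hY : ∀ x : H, X x = Y x) :
    (f, X) ∈ kerAdjoint H (schwarzschild m) 0 ↔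
      ContDiffOn ℝ ∞ F H ∧ (∀ i, ContDiffOn ℝ ∞ (fun y => Y y i) H) ∧
      ∀ x ∈ interior H,
        (∀ a b, hess (schwarzschild m) F x a b = F x * ricci (schwarzschild m) x a b) ∧
        (∀ a b, covUp (schwarzschild m) Y x a b + covUp (schwarzschild m) Y x b a = 0) := by
  show SmoothOn H f ∧ SmoothOn H X ∧ AdjointEq H (schwarzschild m) 0 f X 0 0 ↔ _
  rw [smoothOn_iff hF, smoothOn_iff hY, adjointEq_zero_iff hHm hF hY, contDiffOn_pi]
  refine and_congr_right fun hFs => and_congr_right fun hYs => ?_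
  have hFi := hFs.mono interior_subset
  have hYi := fun i => (hYs i).mono interior_subset
  have hUe : interior H ⊆ exterior m := interior_subset.trans hHe
  rw [weak_iff_pointwise hHm hHe hFi hYi]
  refine forall_congr' fun x => forall_congr' fun hx => ?_
  rw [← staticUp_eq_zero_iff isOpen_interior hUe hx hFi]
  exact ⟨fun h => ⟨fun a b => (h a b).1, fun a b => (h a b).2⟩,
    fun h a b => ⟨h.1 a b, h.2 a b⟩⟩

theorem hess_const_mul {U : Set E3} {f : E3 → ℝ} {x : E3} (hU : IsOpen U)
    (hf : ContDiffOn ℝ ∞ f U) (hx : x ∈ U) (g : Tensor2) (c : ℝ) (a b : Fin 3) :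
    hess g (fun y => c * f y) x a b = c * hess g f x a b := by
  have h1 : ∀ y ∈ U, ∀ k, pd k (fun z => c * f z) y = c * pd k f y := fun y hy k =>
    ((hasGrad_of_smooth hU hf hy).const_mul c).pd_eq k
  rw [hess, hess, mul_sub, Finset.mul_sum, pd_congr hU (fun y hy => h1 y hy b) hx a,
    ((hasGrad_of_smooth hU (smooth_pd hU hf b) hx).const_mul c).pd_eq]
  congr 1
  exact Finset.sum_congr rfl fun k _ => by rw [h1 x hx]; ring

/-- The matrix of the rotation field `c₁ Ω₁ + c₂ Ω₂ + c₃ Ω₃`. -/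
def rotMatrix (c₁ c₂ c₃ : ℝ) : Matrix (Fin 3) (Fin 3) ℝ :=
  !![0, -c₃, c₂; c₃, 0, -c₁; -c₂, c₁, 0]

theorem rot_combination_apply (c₁ c₂ c₃ : ℝ) (x : E3) (i : Fin 3) :
    (c₁ • rot1 x + c₂ • rot2 x + c₃ • rot3 x) i = ∑ k, rotMatrix c₁ c₂ c₃ i k * x k := by
  rw [Fin.sum_univ_three]
  fin_cases i <;> simp [rot1, rot2, rot3, rotMatrix] <;> ring

theorem rot_combination_smooth (c₁ c₂ c₃ : ℝ) (U : Set E3) (i : Fin 3) :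
    ContDiffOn ℝ ∞ (fun x => (c₁ • rot1 x + c₂ • rot2 x + c₃ • rot3 x) i) U := by
  simp only [rot_combination_apply]
  exact ContDiffOn.sum fun k _ => contDiffOn_const.mul (coord_smooth U k)

theorem covUp_rot_combination {x : E3} (hx : x ∈ exterior m) (c₁ c₂ c₃ : ℝ) (a b : Fin 3) :
    covUp (schwarzschild m) (fun y => c₁ • rot1 y + c₂ • rot2 y + c₃ • rot3 y) x a b
      + covUp (schwarzschild m) (fun y => c₁ • rot1 y + c₂ • rot2 y + c₃ • rot3 y) x b a = 0 := by
  refine (covUp_eq_zero_iff (isOpen_exterior m) subset_rfl hx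
    (rot_combination_smooth c₁ c₂ c₃ _)).2 (fun a b => ?_) a b
  have hξ : ∀ y : E3, ∑ k, y k * (c₁ • rot1 y + c₂ • rot2 y + c₃ • rot3 y) k = 0 := by
    intro y
    simp [Fin.sum_univ_three, rot1, rot2, rot3]
    ring
  have hp : ∀ a b, pd a (fun y => (c₁ • rot1 y + c₂ • rot2 y + c₃ • rot3 y) b) x =
      rotMatrix c₁ c₂ c₃ b a := by
    intro a b
    simp only [rot_combination_apply]
    rw [(HasGrad.sum Finset.univ fun k _ =>
      (hasGrad_coord k x).const_mul (rotMatrix c₁ c₂ c₃ b k)).pd_eq, sum_mul_kd]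
  have hM : rotMatrix c₁ c₂ c₃ b a + rotMatrix c₁ c₂ c₃ a b = 0 := by
    fin_cases a <;> fin_cases b <;> simp [rotMatrix]
  simp only [hξ, hp, hM, (HasGrad.const 0).pd_eq]
  ring

theorem mem_kerAdjoint_shell_iff (hm : m ≠ 0) (hI : I.OrdConnected)
    (hne : (interior I).Nonempty) (hpos : ∀ r ∈ I, 0 < r) (hout : ∀ r ∈ I, 2 * m < r)
    (f : shell I → ℝ) (X : shell I → Fin 3 → ℝ) :
    (f, X) ∈ kerAdjoint (shell I) (schwarzschild m) 0 ↔
      ∃ c c₁ c₂ c₃ : ℝ, (∀ x : shell I, f x = c * lapse m x) ∧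
        ∀ x : shell I, X x = c₁ • rot1 x + c₂ • rot2 x + c₃ • rot3 x := by
  have hHm := measurableSet_shell hI
  have hHe := shell_subset_exterior hpos hout
  have hcl := shell_subset_closure hI hne hpos
  have hUo := isOpen_shell_interior I
  have hUi := shell_interior_subset I
  have hUH : shell (interior I) ⊆ shell I := hUi.trans interior_subset
  have hUe := hUH.trans hHe
  constructor
  · intro h
    have hF : ∀ x : shell I, f x = Function.extend Subtype.val f 0 (x : E3) := fun x =>
      (Subtype.val_injective.extend_apply f 0 x).symm
    have hY : ∀ x : shell I, X x = Function.extend Subtype.val X 0 (x : E3) := fun x =>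
      (Subtype.val_injective.extend_apply X 0 x).symm
    obtain ⟨hFs, hYs, hpt⟩ := (mem_kerAdjoint_iff hHm hHe hF hY).1 h
    have hUc : IsPreconnected (shell (interior I)) :=
      isPreconnected_shell hI.interior fun r hr => hpos r (interior_subset hr)
    obtain ⟨c, hc⟩ := static_potential_eq hUo hUc hUe hm (hFs.mono hUH)
      fun x hx => (hpt x (hUi hx)).1
    obtain ⟨c₁, c₂, c₃, hr⟩ := killing_eq hUo hUc hUe hm (fun i => (hYs i).mono hUH)
      fun x hx => (hpt x (hUi hx)).2
    refine ⟨c, c₁, c₂, c₃, fun x => ?_, fun x => ?_⟩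
    · rw [hF]
      -- The formula is known on the open shell, which is dense in the full one; both sides are
      -- continuous up to the included boundary.
      have hE : Set.EqOn (Function.extend Subtype.val f 0) (fun y => c * lapse m y)
          (shell (interior I)) := hc
      exact hE.of_subset_closure hFs.continuousOn
        (continuousOn_const.mul (lapse_smooth.mono hHe).continuousOn) hUH hcl x.2
    · rw [hY]
      have hE : Set.EqOn (Function.extend Subtype.val X 0)
          (fun y => c₁ • rot1 y + c₂ • rot2 y + c₃ • rot3 y) (shell (interior I)) := hr
      exact hE.of_subset_closure (continuousOn_pi.2 fun i => (hYs i).continuousOn)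
        (continuousOn_pi.2 fun i => (rot_combination_smooth c₁ c₂ c₃ _ i).continuousOn) hUH hcl x.2
  · rintro ⟨c, c₁, c₂, c₃, hf, hX⟩
    refine (mem_kerAdjoint_iff hHm hHe (F := fun y => c * lapse m y)
      (Y := fun y => c₁ • rot1 y + c₂ • rot2 y + c₃ • rot3 y) hf hX).2
      ⟨contDiffOn_const.mul (lapse_smooth.mono hHe), rot_combination_smooth c₁ c₂ c₃ _,
        fun x hx => ⟨fun a b => ?_, covUp_rot_combination (hHe (interior_subset hx)) c₁ c₂ c₃⟩⟩
    have hxe := hHe (interior_subset hx)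
    rw [hess_const_mul (isOpen_exterior m) lapse_smooth hxe, hess_lapse hxe, mul_assoc]

/-- The lapse and the three rotation fields, as pairs on the shell. -/
def kerBasis (m : ℝ) (I : Set ℝ) : Fin 4 → (shell I → ℝ) × (shell I → Fin 3 → ℝ) :=
  ![((fun x => lapse m x), 0), (0, fun x => rot1 x), (0, fun x => rot2 x), (0, fun x => rot3 x)]

theorem sum_smul_kerBasis (c : Fin 4 → ℝ) :
    ∑ i, c i • kerBasis m I i = ((fun x : shell I => c 0 * lapse m x),
      fun x : shell I => c 1 • rot1 x + c 2 • rot2 x + c 3 • rot3 x) := by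
  ext x i <;> simp [Fin.sum_univ_four, kerBasis]

theorem linearIndependent_kerBasis (hne : (interior I).Nonempty) (hpos : ∀ r ∈ I, 0 < r)
    (hout : ∀ r ∈ I, 2 * m < r) : LinearIndependent ℝ (kerBasis m I) := by
  rw [Fintype.linearIndependent_iff]
  intro c hc
  rw [sum_smul_kerBasis] at hc
  obtain ⟨r, hr⟩ := hne
  have hrI := interior_subset hr
  have hr0 := hpos r hrI
  have hmem : ∀ i : Fin 3, EuclideanSpace.single i r ∈ shell I := by
    intro i
    show ‖EuclideanSpace.single i r‖ ∈ I
    rw [PiLp.norm_single, Real.norm_of_nonneg hr0.le]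
    exact hrI
  have h1 : ∀ x : shell I, c 0 * lapse m x = 0 := fun x => congrFun (congrArg Prod.fst hc) x
  have h2 : ∀ x : shell I, c 1 • rot1 x + c 2 • rot2 x + c 3 • rot3 x = 0 :=
    fun x => congrFun (congrArg Prod.snd hc) x
  have c0 : c 0 = 0 := by
    refine (mul_eq_zero.1 (h1 ⟨_, hmem 0⟩)).resolve_right ?_
    rw [lapse_eq_inv (shell_subset_exterior hpos hout (hmem 0))]
    exact inv_ne_zero
      (volDensity_schwarzschild_pos (shell_subset_exterior hpos hout (hmem 0))).ne'
  -- On the first coordinate axis `Ω₁` vanishes, so two components isolate the coefficients of `Ω₃`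
  -- and `Ω₂`; a point on the second axis isolates that of `Ω₁`.
  have a1 := congrFun (h2 ⟨_, hmem 0⟩) 1
  have a2 := congrFun (h2 ⟨_, hmem 0⟩) 2
  have a3 := congrFun (h2 ⟨_, hmem 1⟩) 2
  simp [rot1, rot2, rot3, hr0.ne'] at a1 a2 a3
  intro i
  fin_cases i <;> assumption

end Shell

end Constraint

end

/-! ### Dimension and spanning set of the kernel -/

theorem mainTheorem7 (m₀ : ℝ) (hm : m₀ ≠ 0) (I : Set ℝ) (hI : I.OrdConnected)
    (hne : (interior I).Nonempty) (hpos : ∀ r ∈ I, 0 < r) (hout : ∀ r ∈ I, 2 * m₀ < r) :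
    ∃ K : Submodule ℝ
        ((Constraint.shell I → ℝ) × (Constraint.shell I → Fin 3 → ℝ)),
      (K : Set ((Constraint.shell I → ℝ) × (Constraint.shell I → Fin 3 → ℝ))) =
          Constraint.kerAdjoint (Constraint.shell I) (Constraint.schwarzschild m₀) 0 ∧
        Module.finrank ℝ K = 4 ∧
        K = Submodule.span ℝ
          {((fun x : Constraint.shell I => Constraint.lapse m₀ x), 0),
            (0, fun x : Constraint.shell I => Constraint.rot1 x),
            (0, fun x : Constraint.shell I => Constraint.rot2 x),
            (0, fun x : Constraint.shell I => Constraint.rot3 x)} := by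
  refine ⟨Submodule.span ℝ (Set.range (Constraint.kerBasis m₀ I)), ?_, ?_, ?_⟩
  · ext ⟨f, X⟩
    rw [Constraint.mem_kerAdjoint_shell_iff hm hI hne hpos hout, SetLike.mem_coe,
      Submodule.mem_span_range_iff_exists_fun]
    simp only [Constraint.sum_smul_kerBasis, Prod.mk.injEq, funext_iff]
    constructor
    · rintro ⟨c, h1, h2⟩
      exact ⟨c 0, c 1, c 2, c 3, fun x => (h1 x).symm, fun x i => (h2 x i).symm⟩
    · rintro ⟨c, c₁, c₂, c₃, h1, h2⟩
      exact ⟨![c, c₁, c₂, c₃], fun x => (h1 x).symm, fun x i => (h2 x i).symm⟩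
  · rw [finrank_span_eq_card (Constraint.linearIndependent_kerBasis hne hpos hout),
      Fintype.card_fin]
  · congr 1
    simp only [Constraint.kerBasis, Matrix.range_cons, Matrix.range_empty, Set.union_empty,
      Set.singleton_union]
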